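/- Let $R$ be a complete noetherian (commutative) local ring and let $\mathcal{E}$ be an idempotent complete exact $R$-category (i.e. an $R$-linear additive category, in which every idempotent splits, with a Quillen exact structure) that is Hom-noetherian: $\mathcal{E}(X,Y)$ is a finitely generated $R$-module for all $X,Y\in\mathcal{E}$. Call a conflation $0\to X\xrightarrow{f}Y\xrightarrow{g}Z\to 0$ an AR conflation if $f$ is left almost split and $g$ is right almost split, where $g:Y\to Z$ is right almost split if $Z$ is indecomposable, $g$ lies in the Jacobson radical $\mathcal{J}$ of $\mathcal{E}$, and every morphism $W\to Z$ in $\mathcal{J}$ factors through $g$; left almost split is the dual notion. Assume that $\mathcal{E}$ has AR conflations: for every indecomposable non-projective object $Z$ there is an AR conflation ending at $Z$, and for every indecomposable non-injective object $X$ there is an AR conflation starting at $X$. Suppose that one of the following holds: 1. $\mathcal{E}$ has enough projectives and every object $X$ of $\mathcal{E}$ has finite projective dimension, i.e. there is $n\ge 0$ with $\Omega^n X=0$ in the stable category $\underline{\mathcal{E}}=\mathcal{E}/[\mathcal{P}]$, where $\mathcal{P}$ is the class of projective objects and $\Omega$ is the syzygy functor; or 2. $\mathcal{E}$ is Frobenius,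 i.e. it has enough projectives and enough injectives, and the projective objects coincide with the injective objects. Then $\mathcal{E}$ satisfies the following condition. (CF) If $0\to X\xrightarrow{f_i}Y\xrightarrow{g_i}Z\to 0$ $(i=1,2)$ are two conflations in $\mathcal{E}$ with the same terms and $M_i:=\operatorname{Coker}\bigl(\mathcal{E}(-,g_i):\mathcal{E}(-,Y)\to\mathcal{E}(-,Z)\bigr)$, and if $M_1$ has finite length in the category $\operatorname{Mod}\mathcal{E}$ of additive functors $\mathcal{E}^{\mathrm{op}}\to\mathcal{A}b$, then so does $M_2$. -/

import Mathlib

open CategoryTheory CategoryTheory.Limits Opposite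

universe w v u

/-- `i` is the first map of a member of the class `conf` of short sequences. -/
def IsInflationFor {E : Type u} [Category.{v} E] [Preadditive E]
    (conf : ShortComplex E → Prop) {X Y : E} (i : X ⟶ Y) : Prop :=
  ∃ (Z : E) (p : Y ⟶ Z) (w : i ≫ p = 0), conf (ShortComplex.mk i p w)

/-- `p` is the second map of a member of the class `conf` of short sequences. -/
def IsDeflationFor {E : Type u} [Category.{v} E] [Preadditive E]
    (conf : ShortComplex E → Prop) {Y Z : E} (p : Y ⟶ Z) : Prop :=
  ∃ (X : E) (i : X ⟶ Y) (w : i ≫ p = 0), conf (ShortComplex.mk i p w)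

/-- A (Quillen) exact structure on an additive category: a class of kernel-cokernel pairs,
the conflations, closed under isomorphisms and satisfying the axioms
(E0), (E0ᵒᵖ), (E1), (E1ᵒᵖ), (E2), (E2ᵒᵖ) in the form used by Bühler. -/
structure ExactStructure (E : Type u) [Category.{v} E] [Preadditive E]
    [HasZeroObject E] [HasBinaryBiproducts E] where
  /-- The class of conflations `0 ⟶ X ⟶ Y ⟶ Z ⟶ 0`. -/
  Conflation : ShortComplex E → Prop
  isKernel : ∀ S : ShortComplex E, Conflation S →
    Nonempty (IsLimit (KernelFork.ofι S.f S.zero))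
  isCokernel : ∀ S : ShortComplex E, Conflation S →
    Nonempty (IsColimit (CokernelCofork.ofπ S.g S.zero))
  of_iso : ∀ S T : ShortComplex E, Nonempty (S ≅ T) → Conflation S → Conflation T
  inflation_id : ∀ X : E, IsInflationFor Conflation (𝟙 X)
  deflation_id : ∀ X : E, IsDeflationFor Conflation (𝟙 X)
  inflation_comp : ∀ {X Y Z : E} (i : X ⟶ Y) (j : Y ⟶ Z),
    IsInflationFor Conflation i → IsInflationFor Conflation j →
      IsInflationFor Conflation (i ≫ j)
  deflation_comp : ∀ {X Y Z : E} (p : X ⟶ Y) (q : Y ⟶ Z),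
    IsDeflationFor Conflation p → IsDeflationFor Conflation q →
      IsDeflationFor Conflation (p ≫ q)
  /-- The push-out of an inflation along any morphism exists and is an inflation. -/
  inflation_pushout : ∀ {X Y X' : E} (i : X ⟶ Y) (f : X ⟶ X'),
    IsInflationFor Conflation i →
      ∃ (Y' : E) (f' : Y ⟶ Y') (i' : X' ⟶ Y'),
        IsPushout i f f' i' ∧ IsInflationFor Conflation i'
  /-- The pull-back of a deflation along any morphism exists and is a deflation. -/
  deflation_pullback : ∀ {Y Z Z' : E} (p : Y ⟶ Z) (f : Z' ⟶ Z),
    IsDeflationFor Conflation p →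
      ∃ (Y' : E) (f' : Y' ⟶ Y) (p' : Y' ⟶ Z'),
        IsPullback f' p' p f ∧ IsDeflationFor Conflation p'

/-- An `R`-category is Hom-noetherian if all its Hom modules are finitely generated. -/
def HomNoetherian (R : Type w) [CommRing R] (E : Type u) [Category.{v} E] [Preadditive E]
    [Linear R E] : Prop :=
  ∀ X Y : E, Module.Finite R (X ⟶ Y)

section AlmostSplit

variable {E : Type u} [Category.{v} E] [Preadditive E]

/-- `f` lies in the Jacobson radical of the category `E`. -/
def InJacobsonRadical {X Y : E} (f : X ⟶ Y) : Prop :=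
  ∀ g : Y ⟶ X, IsIso (𝟙 X - f ≫ g)

variable [HasBinaryBiproducts E]

/-- `g : Y ⟶ Z` is right almost split: `Z` is indecomposable, `g` is in the radical and every
radical morphism to `Z` factors through `g`. -/
def RightAlmostSplit {Y Z : E} (g : Y ⟶ Z) : Prop :=
  Indecomposable Z ∧ InJacobsonRadical g ∧
    ∀ (W : E) (h : W ⟶ Z), InJacobsonRadical h → ∃ k : W ⟶ Y, k ≫ g = h

/-- `f : X ⟶ Y` is left almost split: `X` is indecomposable, `f` is in the radical and every
radical morphism from `X` factors through `f`. -/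
def LeftAlmostSplit {X Y : E} (f : X ⟶ Y) : Prop :=
  Indecomposable X ∧ InJacobsonRadical f ∧
    ∀ (W : E) (h : X ⟶ W), InJacobsonRadical h → ∃ k : Y ⟶ W, f ≫ k = h

end AlmostSplit

section Modules

variable {E : Type u} [Category.{v} E] [Preadditive E]

/-- The functor `W ↦ coker (E(W, g) : E(W, Y) ⟶ E(W, Z))` with values in abelian groups. -/
def cokerHomFunctor {Y Z : E} (g : Y ⟶ Z) : Eᵒᵖ ⥤ AddCommGrpCat.{v} where
  obj W := AddCommGrpCat.of ((W.unop ⟶ Z) ⧸ (Preadditive.rightComp W.unop g).range)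
  map {W W'} a := AddCommGrpCat.ofHom
    (QuotientAddGroup.map _ _ (Preadditive.leftComp Z a.unop) (by
      rintro _ ⟨k, rfl⟩
      exact ⟨a.unop ≫ k, by simp [Preadditive.leftComp, Preadditive.rightComp]⟩))
  map_id W := by
    ext x
    simp [Preadditive.leftComp]
  map_comp a b := by
    ext x
    simp [Preadditive.leftComp]

instance cokerHomFunctor_additive {Y Z : E} (g : Y ⟶ Z) : (cokerHomFunctor g).Additive where
  map_add {W W' a b} := by
    ext x
    obtain ⟨x, rfl⟩ := QuotientAddGroup.mk_surjective x
    change (QuotientAddGroup.mk ((a + b).unop ≫ x) : (W'.unop ⟶ Z) ⧸ _) =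
      QuotientAddGroup.mk (a.unop ≫ x) + QuotientAddGroup.mk (b.unop ≫ x)
    rw [← QuotientAddGroup.mk_add, unop_add, Preadditive.add_comp]

/-- The right `E`-module `Coker E(-, g)`, an object of the category `Mod E` of additive functors
`Eᵒᵖ ⥤ Ab`. -/
def cokerHom {Y Z : E} (g : Y ⟶ Z) : Eᵒᵖ ⥤+ AddCommGrpCat.{v} :=
  AdditiveFunctor.of (cokerHomFunctor g)

/-- A right `E`-module has finite length in `Mod E` if its subobjects satisfy both chain
conditions. -/
def HasFiniteLength (M : Eᵒᵖ ⥤+ AddCommGrpCat.{v}) : Prop :=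
  IsNoetherianObject M ∧ IsArtinianObject M

end Modules

namespace ExactStructure

variable {E : Type u} [Category.{v} E] [Preadditive E] [HasZeroObject E] [HasBinaryBiproducts E]
  (𝓔 : ExactStructure E)

def IsInflation {X Y : E} (i : X ⟶ Y) : Prop := IsInflationFor 𝓔.Conflation i

def IsDeflation {Y Z : E} (p : Y ⟶ Z) : Prop := IsDeflationFor 𝓔.Conflation p

/-- `P` is projective relative to the exact structure. -/
def IsProjective (P : E) : Prop :=
  ∀ ⦃Y Z : E⦄ (p : Y ⟶ Z), 𝓔.IsDeflation p → ∀ f : P ⟶ Z, ∃ k : P ⟶ Y, k ≫ p = f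

/-- `I` is injective relative to the exact structure. -/
def IsInjective (I : E) : Prop :=
  ∀ ⦃X Y : E⦄ (i : X ⟶ Y), 𝓔.IsInflation i → ∀ f : X ⟶ I, ∃ k : Y ⟶ I, i ≫ k = f

def HasEnoughProjectives : Prop :=
  ∀ X : E, ∃ (P : E) (p : P ⟶ X), 𝓔.IsProjective P ∧ 𝓔.IsDeflation p

def HasEnoughInjectives : Prop :=
  ∀ X : E, ∃ (I : E) (i : X ⟶ I), 𝓔.IsInjective I ∧ 𝓔.IsInflation i

def IsFrobenius : Prop :=
  𝓔.HasEnoughProjectives ∧ 𝓔.HasEnoughInjectives ∧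
    ∀ X : E, 𝓔.IsProjective X ↔ 𝓔.IsInjective X

/-- An AR conflation: a conflation `0 ⟶ X ⟶ Y ⟶ Z ⟶ 0` whose first map is left almost split and
whose second map is right almost split. -/
def IsARConflation (S : ShortComplex E) : Prop :=
  𝓔.Conflation S ∧ LeftAlmostSplit S.f ∧ RightAlmostSplit S.g

def HasRightARConflations : Prop :=
  ∀ Z : E, Indecomposable Z → ¬ 𝓔.IsProjective Z →
    ∃ (X Y : E) (f : X ⟶ Y) (g : Y ⟶ Z) (w : f ≫ g = 0),
      𝓔.IsARConflation (ShortComplex.mk f g w)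

def HasLeftARConflations : Prop :=
  ∀ X : E, Indecomposable X → ¬ 𝓔.IsInjective X →
    ∃ (Y Z : E) (f : X ⟶ Y) (g : Y ⟶ Z) (w : f ≫ g = 0),
      𝓔.IsARConflation (ShortComplex.mk f g w)

def HasARConflations : Prop :=
  𝓔.HasRightARConflations ∧ 𝓔.HasLeftARConflations

/-- Two parallel morphisms are stably equal if their difference factors through a projective
object. -/
def stableRel : HomRel E := fun X Y f g =>
  ∃ (P : E) (a : X ⟶ P) (b : P ⟶ Y), 𝓔.IsProjective P ∧ f - g = a ≫ b

/-- The stable category `E / [projectives]`. -/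
abbrev StableCategory : Type u := CategoryTheory.Quotient 𝓔.stableRel

/-- The projection of `E` onto its stable category. -/
abbrev toStable : E ⥤ 𝓔.StableCategory := CategoryTheory.Quotient.functor 𝓔.stableRel

/-- `𝓔.IsSyzygy n X K` means that `K` is an `n`-th syzygy of `X`, i.e. that `K` represents
`Ωⁿ X`: one has `K = X` if `n = 0`, and otherwise there is a conflation
`0 ⟶ L ⟶ P ⟶ X ⟶ 0` with `P` projective such that `K` is an `(n-1)`-st syzygy of `L`. -/
def IsSyzygy : ℕ → E → E → Prop
  | 0, X, K => K = X
  | n + 1, X, K => ∃ (L P : E) (i : L ⟶ P) (p : P ⟶ X) (w : i ≫ p = 0),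
      𝓔.Conflation (ShortComplex.mk i p w) ∧ 𝓔.IsProjective P ∧ IsSyzygy n L K

/-- `X` has finite projective dimension: some `Ωⁿ X` vanishes in the stable category. -/
def HasFiniteProjectiveDimension (X : E) : Prop :=
  ∃ (n : ℕ) (K : E), 𝓔.IsSyzygy n X K ∧ IsZero (𝓔.toStable.obj K)

/-- The condition (CF), conservation of finiteness. -/
def SatisfiesCF : Prop :=
  ∀ ⦃X Y Z : E⦄ (f₁ f₂ : X ⟶ Y) (g₁ g₂ : Y ⟶ Z) (w₁ : f₁ ≫ g₁ = 0) (w₂ : f₂ ≫ g₂ = 0),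
    𝓔.Conflation (ShortComplex.mk f₁ g₁ w₁) → 𝓔.Conflation (ShortComplex.mk f₂ g₂ w₂) →
      HasFiniteLength (cokerHom g₁) → HasFiniteLength (cokerHom g₂)

end ExactStructure

/-! ### Finite algebras over a complete noetherian local ring. -/

section FiniteAlgebra

/-! Write `M_g` for `Coker E(-, g)`, where `g` is the deflation of a conflation, and `m` for the
maximal ideal of `R`.

The values of `M_g` have finite length over `R` (`isArtinian_cokerModule`). For `W` indecomposable
and not projective, take the AR conflation ending at `W`, with first term `A`. If `f : W ⟶ Z` does
not factor through `g`, the class of the AR conflation is a push-out of the pull-back of the given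
conflation along `f`. For `f ∈ m ^ n Hom(W, Z)` this puts the AR class, which is nonzero, into `m ^
n Ext¹(W, A)`; Krull's intersection theorem forbids this for large `n`, so `m ^ n` kills `M_g(W)`.

Hence `M_g` has finite length exactly when the indecomposables in its support are summands of one
object `T` (`exists_retract_of_wellFounded`, `hasFiniteLength_cokerHom`). Indecomposables have local
endomorphism rings because `R` is complete. It remains to bound the support of `M_2` by that of
`M_1`.

Finite projective dimension: rotating a conflation along a projective presentation of `Z` gives a
length formula whose remaining term belongs to a conflation of smaller total dimension. By induction
the length of `M_g(W)` depends only on the terms (`length_cokerModule_eq`), so the supports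
coincide.

Frobenius case: if `M_1` vanishes at `W` and at its cosyzygy `S`, the first conflation gives a short
exact sequence of stable Hom modules from `W`. Counting lengths in the sequence of the second, exact
in the middle, gives `M_2(W) = 0` (`factors_of_length`). If `M_1(S) ≠ 0`, then `W` is a summand of
the syzygy of `T` (`retract_syzygy`). -/

/-- Separatedness is Krull's intersection theorem. Completeness passes from `R` to `M` because the
completion of a finite module is a quotient of its tensor product with the completion of `R`. -/
theorem IsAdicComplete.of_finite {R : Type*} [CommRing R] [IsLocalRing R] [IsNoetherianRing R]
    [IsAdicComplete (IsLocalRing.maximalIdeal R) R] (M : Type*) [AddCommGroup M] [Module R M]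
    [Module.Finite R M] : IsAdicComplete (IsLocalRing.maximalIdeal R) M := by
  set I := IsLocalRing.maximalIdeal R
  have hH : IsHausdorff I M := ⟨fun x hx ↦
    (Ideal.iInf_pow_smul_eq_bot_of_le_jacobson I (IsLocalRing.maximalIdeal_le_jacobson _)).le
      (by simpa [SModEq.zero] using hx)⟩
  have hP : IsPrecomplete I M := by
    rw [← AdicCompletion.of_surjective_iff]
    intro y
    obtain ⟨t, rfl⟩ := AdicCompletion.ofTensorProduct_surjective_of_finite I M y
    induction t with
    | zero => exact ⟨0, by simp⟩
    | add a b ha hb =>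
      obtain ⟨a', ha⟩ := ha
      obtain ⟨b', hb⟩ := hb
      exact ⟨a' + b', by rw [map_add, map_add, ha, hb]⟩
    | tmul r m =>
      obtain ⟨r, rfl⟩ := AdicCompletion.of_surjective I R r
      refine ⟨r • m, ?_⟩
      rw [AdicCompletion.ofTensorProduct_tmul, map_smul]
      ext n
      simp only [AdicCompletion.val_smul_apply, AdicCompletion.of_apply]
      rfl
  exact { hH, hP with }

theorem isUnit_of_isUnit_quotient {S : Type*} [CommRing S] {J : Ideal S}
    (hJ : J ≤ Ideal.jacobson ⊥) {x : S} (hx : IsUnit (Ideal.Quotient.mk J x)) : IsUnit x :=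
  (isLocalHom_of_le_jacobson_bot J hJ).map_nonunit x hx

/-- Fitting's argument in `S ⧸ J`, followed by lifting the resulting idempotent to `S`. -/
theorem isUnit_or_isUnit_one_sub_of_henselian {S : Type*} [CommRing S] (J : Ideal S)
    [HenselianRing S J] [IsArtinianRing (S ⧸ J)]
    (hS : ∀ e : S, e * e = e → e = 0 ∨ e = 1) (a : S) : IsUnit a ∨ IsUnit (1 - a) := by
  have hJ : J ≤ Ideal.jacobson ⊥ := HenselianRing.jac
  let π := Ideal.Quotient.mk J
  obtain ⟨n, c, hc⟩ := IsArtinian.exists_pow_succ_smul_dvd (M := S ⧸ J) (π a) (1 : S ⧸ J)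
  obtain ⟨c, rfl⟩ := Ideal.Quotient.mk_surjective c
  have hc' : π a ^ (n + 1) = π a ^ (n + 1) * (π a * π c) := by
    simp only [smul_eq_mul, mul_one] at hc
    calc π a ^ (n + 1) = π a * π a ^ n := by ring
      _ = π a * (π a ^ n.succ * π c) := by rw [hc]
      _ = _ := by rw [Nat.succ_eq_add_one]; ring
  have hpow : ∀ k, π a ^ (n + 1) = π a ^ (n + 1) * (π a * π c) ^ k := by
    intro k
    induction k with
    | zero => simp
    | succ k ih => rw [pow_succ (π a * π c), ← mul_assoc, ← ih]; exact hc'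
  -- Modulo `J` the powers of `a` stabilise: `a * c` fixes `a ^ (n + 1)`, so this power of `a * c`
  -- is idempotent there.
  set e₀ : S := (a * c) ^ (n + 1) with he₀
  have hπe : π e₀ = (π a * π c) ^ (n + 1) := by simp [he₀]
  have hidem : π e₀ * π e₀ = π e₀ := by
    rw [hπe]
    conv_lhs => rw [mul_pow]
    calc π a ^ (n + 1) * π c ^ (n + 1) * (π a ^ (n + 1) * π c ^ (n + 1))
        = (π a ^ (n + 1) * (π a * π c) ^ (n + 1)) * π c ^ (n + 1) := by rw [mul_pow]; ring
      _ = _ := by rw [← hpow, mul_pow]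
  obtain ⟨e, he, hee⟩ := HenselianRing.is_henselian (I := J)
    (Polynomial.X ^ 2 - Polynomial.X : Polynomial S)
    (by
      apply Polynomial.monic_X_pow_sub (n := 2)
      exact Polynomial.degree_X_le.trans_lt (by norm_num)) e₀
    (by
      rw [← Ideal.Quotient.eq_zero_iff_mem]
      simp only [Polynomial.eval_sub, Polynomial.eval_pow, Polynomial.eval_X, map_sub, map_pow]
      change π e₀ ^ 2 - π e₀ = 0
      rw [pow_two, hidem, sub_self])
    (by
      -- At an idempotent, the derivative `2X - 1` of `X² - X` is its own inverse.
      refine IsUnit.of_mul_eq_one (Ideal.Quotient.mk J (2 * e₀ - 1)) ?_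
      simp only [Polynomial.derivative_X_pow, Polynomial.derivative_X,
        Polynomial.eval_sub, Polynomial.eval_mul, Polynomial.eval_pow, Polynomial.eval_X,
        Polynomial.eval_one, map_sub, map_mul, map_one]
      simp only [Nat.cast_ofNat, Polynomial.eval_C, Nat.add_one_sub_one, pow_one]
      change (Ideal.Quotient.mk J 2 * π e₀ - 1) * (Ideal.Quotient.mk J 2 * π e₀ - 1) = 1
      have h2 : (Ideal.Quotient.mk J 2) = 2 := map_ofNat _ 2
      rw [h2]
      linear_combination 4 * hidem)
  have he' : e * e = e := by
    simpa [Polynomial.IsRoot, sub_eq_zero, pow_two] using he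
  have hπ : π e = π e₀ := (Ideal.Quotient.eq).2 hee
  rcases hS e he' with rfl | rfl
  · right
    apply isUnit_of_isUnit_quotient hJ
    have h0 : π a ^ (n + 1) = 0 := by
      rw [hpow (n + 1), ← hπe, ← hπ]; simp
    rw [map_sub, map_one]
    exact IsNilpotent.isUnit_one_sub ⟨n + 1, h0⟩
  · left
    apply isUnit_of_isUnit_quotient hJ
    rw [hπe, map_one] at hπ
    refine IsUnit.of_mul_eq_one (π c * (π a * π c) ^ n) ?_
    change π a * _ = 1
    rw [← mul_assoc, ← pow_succ', ← hπ]

/-- `M` is a finite module over `R ⧸ m ^ n`, which is artinian since `m` is a minimal prime of `m ^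
n` for `n ≠ 0`. -/
theorem isArtinian_of_pow_smul_eq_bot {R : Type*} [CommRing R] [IsLocalRing R]
    [IsNoetherianRing R] {M : Type*} [AddCommGroup M] [Module R M] [Module.Finite R M] (n : ℕ)
    (h : (IsLocalRing.maximalIdeal R) ^ n • (⊤ : Submodule R M) = ⊥) : IsArtinian R M := by
  set m := IsLocalRing.maximalIdeal R
  obtain rfl | hn := eq_or_ne n 0
  · have : Subsingleton M := by
      rw [pow_zero, Ideal.one_eq_top, Submodule.top_smul] at h
      exact (Submodule.subsingleton_iff R).1 (subsingleton_of_bot_eq_top h.symm)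
    infer_instance
  have hmin : m ∈ (m ^ n).minimalPrimes := by
    refine ⟨⟨inferInstance, Ideal.pow_le_self hn⟩, fun J hJ _ ↦ ?_⟩
    have := hJ.1
    exact Ideal.IsPrime.le_of_pow_le hJ.2
  have : IsArtinianRing (R ⧸ m ^ n) :=
    IsLocalRing.quotient_artinian_of_mem_minimalPrimes_of_isLocalRing _ hmin
  have htors : Module.IsTorsionBySet R M (m ^ n : Ideal R) := by
    intro x r
    rw [← Submodule.mem_bot R, ← h]
    exact Submodule.smul_mem_smul r.2 trivial
  let _ := htors.module
  have : Module.Finite (R ⧸ m ^ n) M := Module.Finite.of_restrictScalars_finite R _ _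
  exact isArtinian_of_surjective_algebraMap (R := R ⧸ m ^ n) Ideal.Quotient.mk_surjective

/-- A module-finite algebra over a complete noetherian local ring without nontrivial idempotents
is local. -/
theorem isUnit_or_isUnit_one_sub_of_finite (R : Type*) [CommRing R] [IsLocalRing R]
    [IsNoetherianRing R] [IsAdicComplete (IsLocalRing.maximalIdeal R) R] {A : Type*} [Ring A]
    [Algebra R A] [Module.Finite R A] (hA : ∀ e : A, e * e = e → e = 0 ∨ e = 1) (a : A) :
    IsUnit a ∨ IsUnit (1 - a) := by
  -- The commutative subalgebra `R[a]` is finite over `R`, hence complete and Henselian, and its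
  -- idempotents are idempotents of `A`.
  let S := Algebra.adjoin R {a}
  let _ : CommRing S := inferInstance
  set m := IsLocalRing.maximalIdeal R
  have : Module.Finite R S := Module.Finite.of_injective S.val.toLinearMap Subtype.val_injective
  have : IsAdicComplete m S := IsAdicComplete.of_finite S
  have : IsAdicComplete (m.map (algebraMap R S)) S :=
    (IsAdicComplete.map_algebraMap_iff _ _).2 inferInstance
  have : IsArtinianRing (S ⧸ m.map (algebraMap R S)) := by
    have : IsArtinian R (S ⧸ m.map (algebraMap R S)) := by
      refine isArtinian_of_pow_smul_eq_bot 1 ?_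
      rw [pow_one, eq_bot_iff, Submodule.smul_le]
      rintro r hr x -
      obtain ⟨x, rfl⟩ := Ideal.Quotient.mk_surjective x
      change Ideal.Quotient.mk _ (r • x) = 0
      rw [Ideal.Quotient.eq_zero_iff_mem, Algebra.smul_def]
      exact Ideal.mul_mem_right _ _ (Ideal.mem_map_of_mem _ hr)
    exact isArtinian_of_tower R this
  have := isUnit_or_isUnit_one_sub_of_henselian (m.map (algebraMap R S)) (fun e he ↦ by
    rcases hA e (by simpa using congrArg Subtype.val he) with h | h
    · exact .inl (Subtype.ext h)
    · exact .inr (Subtype.ext h)) ⟨a, Algebra.self_mem_adjoin_singleton R a⟩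
  rcases this with h | h
  · exact .inl (h.map S.val)
  · exact .inr (by simpa using h.map S.val)

end FiniteAlgebra

/-! ### Local endomorphism rings and decomposition into indecomposables. -/

section KrullSchmidt

variable {E : Type u} [Category.{v} E] [Preadditive E]

/-- The endomorphism ring of `W` is local (or zero). -/
def HasLocalEnd (W : E) : Prop :=
  ∀ a b : W ⟶ W, a + b = 𝟙 W → IsIso a ∨ IsIso b

/-- Jacobson's identity: if `u` inverts `1 - g ≫ f`, then `1 + f ≫ u ≫ g` inverts `1 - f ≫ g`. -/
theorem isIso_id_sub_comp_of_isIso {X Y : E} (f : X ⟶ Y) (g : Y ⟶ X) [IsIso (𝟙 Y - g ≫ f)] :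
    IsIso (𝟙 X - f ≫ g) := by
  have h1 : (𝟙 Y - g ≫ f) ≫ inv (𝟙 Y - g ≫ f) = 𝟙 Y := IsIso.hom_inv_id _
  have h2 : inv (𝟙 Y - g ≫ f) ≫ (𝟙 Y - g ≫ f) = 𝟙 Y := IsIso.inv_hom_id _
  set u := inv (𝟙 Y - g ≫ f)
  rw [Preadditive.sub_comp, Category.id_comp, Category.assoc] at h1
  rw [Preadditive.comp_sub, Category.comp_id] at h2
  refine ⟨𝟙 X + f ≫ u ≫ g, ?_, ?_⟩
  · have : f ≫ (u - g ≫ f ≫ u) ≫ g = f ≫ g := by rw [h1, Category.id_comp]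
    simp only [Preadditive.sub_comp, Preadditive.comp_sub, Category.assoc] at this
    simp only [Preadditive.sub_comp, Preadditive.comp_add, Category.comp_id, Category.id_comp,
      Category.assoc]
    rw [← this]
    abel
  · have : f ≫ (u - u ≫ g ≫ f) ≫ g = f ≫ g := by rw [h2, Category.id_comp]
    simp only [Preadditive.sub_comp, Preadditive.comp_sub, Category.assoc] at this
    simp only [Preadditive.comp_sub, Preadditive.add_comp, Category.comp_id, Category.id_comp,
      Category.assoc]
    rw [sub_eq_iff_eq_add.1 this]
    abel

/-- A morphism to an object with local endomorphism ring is radical unless it is a split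
epimorphism. -/
theorem inJacobsonRadical_of_not_split {Q W : E} (hW : HasLocalEnd W) (f : Q ⟶ W)
    (hf : ∀ s : W ⟶ Q, s ≫ f ≠ 𝟙 W) : InJacobsonRadical f := by
  intro g
  rcases hW (g ≫ f) (𝟙 W - g ≫ f) (by abel) with h | h
  · exact absurd (by rw [Category.assoc]; exact IsIso.inv_hom_id (g ≫ f))
      (hf (inv (g ≫ f) ≫ g))
  · exact isIso_id_sub_comp_of_isIso f g

/-- A radical morphism to a nonzero object is not a split epimorphism. -/
theorem InJacobsonRadical.not_split {Q W : E} {f : Q ⟶ W} (hf : InJacobsonRadical f)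
    (hW : ¬ IsZero W) (s : W ⟶ Q) : s ≫ f ≠ 𝟙 W := by
  intro hs
  have := hf s
  have h0 : s ≫ (𝟙 Q - f ≫ s) = 0 := by
    rw [Preadditive.comp_sub, ← Category.assoc, hs]; simp
  have : s = 0 := by
    rw [← cancel_mono (𝟙 Q - f ≫ s), h0, zero_comp]
  rw [this, zero_comp] at hs
  exact hW ((IsZero.iff_id_eq_zero W).2 hs.symm)

variable [HasBinaryBiproducts E]

/-- Splitting both `e` and `1 - e` writes `W` as the direct sum of their images. -/
theorem CategoryTheory.Indecomposable.eq_zero_or_eq_id [IsIdempotentComplete E] {W : E}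
    (hW : Indecomposable W) (e : W ⟶ W) (he : e ≫ e = e) : e = 0 ∨ e = 𝟙 W := by
  obtain ⟨Y, i, p, hip, hpi⟩ := IsIdempotentComplete.idempotents_split W e he
  obtain ⟨Y', i', p', hip', hpi'⟩ := IsIdempotentComplete.idempotents_split W (𝟙 W - e)
    (by simp [he])
  have h1 : i ≫ p' = 0 := by
    have : i ≫ p' = i ≫ (p' ≫ i') ≫ p' := by simp [hip']
    rw [this, hpi', ← hpi]
    simp [reassoc_of% hip]
  have h2 : i' ≫ p = 0 := by
    have : i' ≫ p = i' ≫ (p ≫ i) ≫ p := by simp [hip]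
    have hp : p ≫ i = 𝟙 W - p' ≫ i' := by rw [hpi, hpi']; abel
    rw [this, hp]
    simp [reassoc_of% hip']
  have iso : W ≅ Y ⊞ Y' :=
    { hom := biprod.lift p p'
      inv := biprod.desc i i'
      hom_inv_id := by rw [biprod.lift_desc, hpi, hpi']; abel
      inv_hom_id := by
        ext <;> simp [hip, hip', h1, h2] }
  rcases hW.2 Y Y' iso with h | h
  · left; rw [← hpi, h.eq_of_tgt p 0, zero_comp]
  · right
    rw [eq_comm, ← sub_eq_zero, ← hpi', h.eq_of_tgt p' 0, zero_comp]

variable {R : Type w} [CommRing R] [IsNoetherianRing R] [Linear R E]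

theorem CategoryTheory.Indecomposable.hasLocalEnd [IsLocalRing R]
    [IsAdicComplete (IsLocalRing.maximalIdeal R) R] [IsIdempotentComplete E] (hHom : HomNoetherian R E) {W : E}
    (hW : Indecomposable W) : HasLocalEnd W := by
  intro a b hab
  have : Module.Finite R (End W) := hHom W W
  obtain rfl : b = 𝟙 W - a := by rw [← hab]; abel
  have := isUnit_or_isUnit_one_sub_of_finite R (A := End W)
    (fun e he ↦ hW.eq_zero_or_eq_id e he) a
  rwa [isUnit_iff_isIso, isUnit_iff_isIso] at this

/-- Every object of a Hom-noetherian additive category is a finite direct sum of indecomposables,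
stated as an induction principle. -/
theorem HomNoetherian.induction_indecomposable (hHom : HomNoetherian R E) (P : E → Prop)
    (zero : ∀ X, IsZero X → P X) (indec : ∀ X, Indecomposable X → P X)
    (sum : ∀ X A B : E, (X ≅ A ⊞ B) → P A → P B → P X) (X : E) : P X := by
  have : Module.Finite R (X ⟶ X) := hHom X X
  -- Noetherian induction over the retracts `A` of `X`, measured by the kernel of `End X → Hom(X,
  -- A)`, which grows strictly when `A` is replaced by a proper summand.
  have key : ∀ (K : Submodule R (X ⟶ X)) (A : E) (s : A ⟶ X) (p : X ⟶ A), s ≫ p = 𝟙 A →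
      LinearMap.ker (Linear.rightComp R X p) = K → P A := by
    intro K
    induction K using WellFoundedGT.induction with
    | ind K ih =>
      intro A s p hsp hK
      by_contra hA
      have hA0 : ¬ IsZero A := fun h ↦ hA (zero A h)
      have hAi : ¬ Indecomposable A := fun h ↦ hA (indec A h)
      simp only [Indecomposable, not_and, not_forall, not_or] at hAi
      obtain ⟨B, C, e, hB, hC⟩ := hAi hA0
      have aux : ∀ (B C : E) (e : A ≅ B ⊞ C), ¬ IsZero C → P B := by
        intro B C e hC
        refine ih (LinearMap.ker (Linear.rightComp R X (p ≫ e.hom ≫ biprod.fst))) ?_ B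
          (biprod.inl ≫ e.inv ≫ s) (p ≫ e.hom ≫ biprod.fst) (by simp [reassoc_of% hsp]) rfl
        rw [← hK]
        refine lt_of_le_of_ne (fun f hf ↦ ?_) (fun h ↦ hC ?_)
        · have hf : f ≫ p = 0 := hf
          change f ≫ p ≫ e.hom ≫ biprod.fst = 0
          rw [reassoc_of% hf, zero_comp]
        -- The idempotent of `X` cutting out `C` dies in `B`; if it also died in `A`, then `C` would
        -- be zero.
        · have h1 : (p ≫ e.hom ≫ biprod.snd) ≫ (biprod.inr ≫ e.inv ≫ s) ∈
              LinearMap.ker (Linear.rightComp R X (p ≫ e.hom ≫ biprod.fst)) := by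
            change _ ≫ _ = 0
            simp [reassoc_of% hsp]
          rw [← h] at h1
          have h1 : ((p ≫ e.hom ≫ biprod.snd) ≫ (biprod.inr ≫ e.inv ≫ s)) ≫ p = 0 := h1
          have h2 : (biprod.inr ≫ e.inv ≫ s) ≫
            (((p ≫ e.hom ≫ biprod.snd) ≫ (biprod.inr ≫ e.inv ≫ s)) ≫ p) ≫
              e.hom ≫ biprod.snd = 𝟙 C := by simp [reassoc_of% hsp]
          rw [h1] at h2
          rw [IsZero.iff_id_eq_zero, ← h2]
          simp
      exact hA (sum A B C e (aux B C e hC)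
        (aux C B (e ≪≫ biprod.braiding B C) hB))
  exact key _ X (𝟙 X) (𝟙 X) (by simp) rfl

end KrullSchmidt

/-! ### Submodules by elements versus categorical subobjects. -/

section Subfunctors

variable {E : Type u} [Category.{v} E] [Preadditive E]

/-- The action of a morphism on the elements of a right module. -/
def restr (M : Eᵒᵖ ⥤+ AddCommGrpCat.{v}) {W V : E} (a : V ⟶ W) :
    M.obj.obj (op W) →+ M.obj.obj (op V) :=
  (M.obj.map a.op).hom

section restr

variable (M : Eᵒᵖ ⥤+ AddCommGrpCat.{v})

@[simp]
theorem restr_id {W : E} (x : M.obj.obj (op W)) : restr M (𝟙 W) x = x := by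
  simp [restr]

theorem restr_comp {W V U : E} (b : U ⟶ V) (a : V ⟶ W) (x : M.obj.obj (op W)) :
    restr M (b ≫ a) x = restr M b (restr M a x) := by
  simp [restr]

theorem restr_add {W V : E} (a b : V ⟶ W) (x : M.obj.obj (op W)) :
    restr M (a + b) x = restr M a x + restr M b x := by
  simp [restr, Functor.map_add]

@[simp]
theorem restr_zero {W V : E} (x : M.obj.obj (op W)) : restr M (0 : V ⟶ W) x = 0 := by
  simp [restr, Functor.map_zero]

theorem restr_neg {W V : E} (a : V ⟶ W) (x : M.obj.obj (op W)) :
    restr M (-a) x = - restr M a x := by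
  simp [restr, Functor.map_neg]

end restr

/-- A submodule of a right module `M`, given by its subgroups of elements. -/
@[ext]
structure Subfun (M : Eᵒᵖ ⥤+ AddCommGrpCat.{v}) where
  carrier : ∀ W : E, AddSubgroup (M.obj.obj (op W))
  restr_mem : ∀ {W V : E} (a : V ⟶ W) (x : M.obj.obj (op W)), x ∈ carrier W →
    restr M a x ∈ carrier V

namespace Subfun

variable {M : Eᵒᵖ ⥤+ AddCommGrpCat.{v}}

instance : PartialOrder (Subfun M) :=
  PartialOrder.lift carrier fun _ _ h ↦ Subfun.ext h

instance : OrderBot (Subfun M) where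
  bot := ⟨fun _ ↦ ⊥, by
    rintro W V a x hx
    rw [AddSubgroup.mem_bot] at hx ⊢
    rw [hx, map_zero]⟩
  bot_le N W := (bot_le : ⊥ ≤ N.carrier W)

instance : OrderTop (Subfun M) where
  top := ⟨fun _ ↦ ⊤, fun _ _ _ ↦ trivial⟩
  le_top N W := (le_top : N.carrier W ≤ ⊤)

/-- The functor underlying a submodule. -/
def functor (N : Subfun M) : Eᵒᵖ ⥤ AddCommGrpCat.{v} where
  obj W := AddCommGrpCat.of (N.carrier W.unop)
  map {W V} a := AddCommGrpCat.ofHom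
    (((restr M a.unop).comp (N.carrier W.unop).subtype).codRestrict (N.carrier V.unop)
      fun x ↦ N.restr_mem _ _ x.2)
  map_id W := by
    ext x
    exact restr_id M (Subtype.val x)
  map_comp a b := by
    ext x
    exact restr_comp M b.unop a.unop (Subtype.val x)

instance (N : Subfun M) : N.functor.Additive where
  map_add {W V a b} := by
    ext x
    exact Subtype.ext (restr_add M a.unop b.unop _)

/-- The inclusion of a submodule. -/
def ι (N : Subfun M) : AdditiveFunctor.of N.functor ⟶ M :=
  ⟨{ app := fun W ↦ AddCommGrpCat.ofHom (N.carrier W.unop).subtype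
     naturality := fun W V a ↦ by
      ext x
      rfl }⟩

instance (N : Subfun M) : Mono N.ι where
  right_cancellation {F} f g h := by
    ext W x
    have := congrArg (fun t ↦ (t.hom.app W).hom x) h
    exact Subtype.ext this

/-- The inclusion between two submodules. -/
def inclusion {N N' : Subfun M} (h : N ≤ N') :
    AdditiveFunctor.of N.functor ⟶ AdditiveFunctor.of N'.functor :=
  ⟨{ app := fun W ↦ AddCommGrpCat.ofHom (AddSubgroup.inclusion (h W.unop))
     naturality := fun W V a ↦ by
      ext x
      rfl }⟩

/-- Submodules given by elements embed into categorical subobjects. -/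
noncomputable def toSubobject : Subfun M ↪o Subobject M :=
  OrderEmbedding.ofMapLEIff (fun N ↦ Subobject.mk N.ι) fun N N' ↦ by
    refine ⟨fun h W x hx ↦ ?_, fun h ↦ Subobject.mk_le_mk_of_comm (inclusion h) rfl⟩
    have h1 := Subobject.ofMkLEMk_comp h
    have h2 := congrArg (fun t ↦ (t.hom.app (op W)).hom ⟨x, hx⟩) h1
    have h3 : (((Subobject.ofMkLEMk N.ι N'.ι h).hom.app (op W)).hom ⟨x, hx⟩ :
      N'.carrier W).1 = x := h2
    rw [← h3]
    exact Subtype.prop _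

/-- The elementwise kernel is itself a submodule, and its inclusion composed with `i` is zero. -/
theorem mono_injective {F : Eᵒᵖ ⥤+ AddCommGrpCat.{v}} (i : F ⟶ M) [Mono i] (W : E) :
    Function.Injective (i.hom.app (op W)).hom := by
  rw [injective_iff_map_eq_zero]
  intro x hx
  have hnat : ∀ {W V : E} (a : V ⟶ W) (x : F.obj.obj (op W)),
      (i.hom.app (op V)).hom (restr F a x) = restr M a ((i.hom.app (op W)).hom x) :=
    fun a x ↦ congrArg (fun t ↦ t.hom x) (i.hom.naturality a.op)
  let K : Subfun F := ⟨fun W ↦ (i.hom.app (op W)).hom.ker, by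
    intro W V a x hx
    rw [AddMonoidHom.mem_ker] at hx ⊢
    rw [hnat, hx, map_zero]⟩
  have h0 : K.ι ≫ i = 0 := by
    ext W y
    exact y.2
  have h1 : K.ι = 0 := by rw [← cancel_mono i, h0, zero_comp]
  exact congrArg (fun t ↦ (t.hom.app (op W)).hom (⟨x, hx⟩ : K.carrier W)) h1

/-- The elements of a subobject. -/
noncomputable def ofSubobject (S : Subobject M) : Subfun M where
  carrier W := (S.arrow.hom.app (op W)).hom.range
  restr_mem := by
    rintro W V a _ ⟨x, rfl⟩
    exact ⟨restr _ a x, congrArg (fun t ↦ t.hom x) (S.arrow.hom.naturality a.op)⟩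

/-- An inclusion that is bijective on elements is invertible. Together with `toSubobject` this
transfers chain conditions in both directions. -/
theorem ofSubobject_strictMono : StrictMono (ofSubobject (M := M)) := by
  intro S S' hlt
  have hcomm : ∀ (W : E) (x), (S'.arrow.hom.app (op W)).hom
      (((Subobject.ofLE S S' hlt.le).hom.app (op W)).hom x) = (S.arrow.hom.app (op W)).hom x :=
    fun W x ↦ congrArg (fun t ↦ (t.hom.app (op W)).hom x) (Subobject.ofLE_arrow hlt.le)
  have hle : ofSubobject S ≤ ofSubobject S' := by
    rintro W _ ⟨x, rfl⟩
    exact ⟨_, hcomm W x⟩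
  refine lt_of_le_of_ne hle fun heq ↦ ?_
  have hiso : ∀ W : Eᵒᵖ, IsIso ((Subobject.ofLE S S' hlt.le).hom.app W) := by
    intro W
    rw [ConcreteCategory.isIso_iff_bijective]
    refine ⟨mono_injective _ W.unop, fun y ↦ ?_⟩
    have hy : (S'.arrow.hom.app W).hom y ∈ (ofSubobject S).carrier W.unop := by
      rw [heq]
      exact ⟨y, rfl⟩
    obtain ⟨x, hx⟩ := hy
    exact ⟨x, mono_injective S'.arrow W.unop ((hcomm W.unop x).trans hx)⟩
  have : IsIso (Subobject.ofLE S S' hlt.le).hom := NatIso.isIso_of_isIso_app _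
  have : IsIso (Subobject.ofLE S S' hlt.le) := by
    have : IsIso ((AdditiveFunctor.forget _ _).map (Subobject.ofLE S S' hlt.le)) := this
    exact isIso_of_fully_faithful (AdditiveFunctor.forget _ _) _
  exact hlt.not_ge (Subobject.le_of_comm (inv (Subobject.ofLE S S' hlt.le)) (by simp))

end Subfun

theorem HasFiniteLength.wellFoundedGT {M : Eᵒᵖ ⥤+ AddCommGrpCat.{v}} (h : HasFiniteLength M) :
    WellFoundedGT (Subfun M) := by
  have := h.1
  exact Subfun.toSubobject.wellFoundedGT

theorem HasFiniteLength.wellFoundedLT {M : Eᵒᵖ ⥤+ AddCommGrpCat.{v}} (h : HasFiniteLength M) :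
    WellFoundedLT (Subfun M) := by
  have := h.2
  exact Subfun.toSubobject.wellFoundedLT

theorem hasFiniteLength_of_wellFounded (M : Eᵒᵖ ⥤+ AddCommGrpCat.{v})
    [WellFoundedGT (Subfun M)] [WellFoundedLT (Subfun M)] : HasFiniteLength M :=
  ⟨⟨(Subfun.ofSubobject_strictMono (M := M)).wellFoundedGT⟩,
    ⟨(Subfun.ofSubobject_strictMono (M := M)).wellFoundedLT⟩⟩

end Subfunctors

/-! ### Finite length forces finite support. -/

section Support

variable {E : Type u} [Category.{v} E] [Preadditive E]

/-- The submodule `N + {x ∘ h | h ∈ I}` of `M`, where `I` is a right ideal of morphisms to `W`. -/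
def Subfun.adjoin {M : Eᵒᵖ ⥤+ AddCommGrpCat.{v}} (N : Subfun M) {W : E} (x : M.obj.obj (op W))
    (I : ∀ V : E, AddSubgroup (V ⟶ W)) (hI : ∀ {V V' : E} (a : V' ⟶ V) (h : V ⟶ W),
      h ∈ I V → a ≫ h ∈ I V') : Subfun M where
  carrier V :=
    { carrier := {y | ∃ n ∈ N.carrier V, ∃ h ∈ I V, y = n + restr M h x}
      zero_mem' := ⟨0, zero_mem _, 0, zero_mem _, by simp⟩
      add_mem' := by
        rintro _ _ ⟨n, hn, h, hh, rfl⟩ ⟨n', hn', h', hh', rfl⟩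
        refine ⟨n + n', add_mem hn hn', h + h', add_mem hh hh', ?_⟩
        rw [restr_add]
        abel
      neg_mem' := by
        rintro _ ⟨n, hn, h, hh, rfl⟩
        refine ⟨-n, neg_mem hn, -h, neg_mem hh, ?_⟩
        rw [restr_neg]
        abel }
  restr_mem := by
    rintro V V' a _ ⟨n, hn, h, hh, rfl⟩
    refine ⟨restr M a n, N.restr_mem a n hn, a ≫ h, hI a h hh, ?_⟩
    rw [map_add, restr_comp]

theorem Subfun.le_adjoin {M : Eᵒᵖ ⥤+ AddCommGrpCat.{v}} (N : Subfun M) {W : E}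
    (x : M.obj.obj (op W)) (I : ∀ V : E, AddSubgroup (V ⟶ W))
    (hI : ∀ {V V' : E} (a : V' ⟶ V) (h : V ⟶ W), h ∈ I V → a ≫ h ∈ I V') :
    N ≤ N.adjoin x I hI :=
  fun _ y hy ↦ ⟨y, hy, 0, zero_mem _, by simp⟩

theorem Subfun.adjoin_le {M : Eᵒᵖ ⥤+ AddCommGrpCat.{v}} {N N' : Subfun M} (hN : N ≤ N') {W : E}
    {x : M.obj.obj (op W)} (hx : x ∈ N'.carrier W) (I : ∀ V : E, AddSubgroup (V ⟶ W))
    (hI : ∀ {V V' : E} (a : V' ⟶ V) (h : V ⟶ W), h ∈ I V → a ≫ h ∈ I V') :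
    N.adjoin x I hI ≤ N' := by
  rintro V _ ⟨n, hn, h, -, rfl⟩
  exact add_mem (hN V hn) (N'.restr_mem h x hx)

/-- The morphisms `h : V ⟶ W` to an object with local endomorphism ring which are not split
epimorphisms. -/
def nonSplit {W : E} (hW : HasLocalEnd W) (hW0 : ¬ IsZero W) (V : E) : AddSubgroup (V ⟶ W) where
  carrier := {h | ∀ s : W ⟶ V, ¬ IsIso (s ≫ h)}
  zero_mem' s hs := by
    rw [comp_zero] at hs
    exact hW0 ((IsZero.iff_isSplitMono_eq_zero (0 : W ⟶ W)).2 rfl)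
  add_mem' := by
    intro h h' hh hh' s hs
    have : inv (s ≫ (h + h')) ≫ s ≫ h + inv (s ≫ (h + h')) ≫ s ≫ h' = 𝟙 W := by
      rw [← Preadditive.comp_add, ← Preadditive.comp_add]
      exact IsIso.inv_hom_id _
    rcases hW _ _ this with h1 | h1
    · exact hh (inv (s ≫ (h + h')) ≫ s) (by rwa [Category.assoc])
    · exact hh' (inv (s ≫ (h + h')) ≫ s) (by rwa [Category.assoc])
  neg_mem' := by
    intro h hh s hs
    exact hh (-s) (by rw [Preadditive.neg_comp]; rwa [Preadditive.comp_neg] at hs)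

variable [HasBinaryBiproducts E]

section

variable {R : Type w} [CommRing R] [IsNoetherianRing R] [Linear R E]

theorem Subfun.le_of_indecomposable (hHom : HomNoetherian R E) {M : Eᵒᵖ ⥤+ AddCommGrpCat.{v}}
    {N N' : Subfun M} (h : ∀ W, Indecomposable W → N'.carrier W ≤ N.carrier W) : N' ≤ N := by
  intro W
  refine hHom.induction_indecomposable (fun W ↦ N'.carrier W ≤ N.carrier W) ?_ h ?_ W
  · intro X hX x _
    have : restr M (𝟙 X) x = 0 := by
      rw [hX.eq_of_src (𝟙 X) 0, restr_zero]
    rw [restr_id] at this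
    rw [this]
    exact zero_mem _
  · intro X A B e hA hB x hx
    have h1 : (e.hom ≫ biprod.fst) ≫ (biprod.inl ≫ e.inv) +
        (e.hom ≫ biprod.snd) ≫ (biprod.inr ≫ e.inv) = 𝟙 X := by
      have : e.hom ≫ (biprod.fst ≫ biprod.inl + biprod.snd ≫ biprod.inr) ≫ e.inv = 𝟙 X := by
        rw [biprod.total]; simp
      simpa only [Preadditive.add_comp, Preadditive.comp_add, Category.assoc] using this
    rw [← restr_id M x, ← h1, restr_add, restr_comp, restr_comp M (e.hom ≫ biprod.snd)]
    exact add_mem (N.restr_mem _ _ (hA (N'.restr_mem _ _ hx)))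
      (N.restr_mem _ _ (hB (N'.restr_mem _ _ hx)))

/-- The support of a right module of finite length consists, up to isomorphism, of the
indecomposable direct summands of a single object. -/
theorem exists_retract_of_wellFounded [IsIdempotentComplete E] [HasZeroObject E]
    (hHom : HomNoetherian R E)
    (hloc : ∀ W : E, Indecomposable W → HasLocalEnd W) (M : Eᵒᵖ ⥤+ AddCommGrpCat.{v})
    [WellFoundedGT (Subfun M)] [WellFoundedLT (Subfun M)] :
    ∃ T : E, ∀ W, Indecomposable W → ∀ x : M.obj.obj (op W), x ≠ 0 → Nonempty (Retract W T) := by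
  -- Take `N` maximal in this set. If `N ≠ ⊤`, a minimal `N'` above it has a simple quotient `N' /
  -- N`, supported at a single indecomposable `W`, so `N'` also belongs to the set.
  let supp : Set (Subfun M) := {N | ∃ T : E, ∀ W, Indecomposable W → ∀ x ∈ N.carrier W, x ≠ 0 →
    Nonempty (Retract W T)}
  obtain ⟨O, -⟩ := HasZeroObject.zero (C := E)
  have hne : supp.Nonempty := ⟨⊥, O, fun W _ x hx hx0 ↦ absurd hx hx0⟩
  obtain ⟨N, ⟨T, hT⟩, hmax⟩ := WellFounded.has_min
    (wellFounded_gt : WellFounded ((· > ·) : Subfun M → Subfun M → Prop)) supp hne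
  by_cases htop : N = ⊤
  · subst htop
    exact ⟨T, fun W hW x hx ↦ hT W hW x trivial hx⟩
  exfalso
  obtain ⟨N', hN', hmin⟩ := WellFounded.has_min
    (wellFounded_lt : WellFounded ((· < ·) : Subfun M → Subfun M → Prop)) {N' | N < N'}
    ⟨⊤, lt_top_iff_ne_top.2 htop⟩
  have hN' : N < N' := hN'
  obtain ⟨W, hW, x, hx', hx⟩ : ∃ W, Indecomposable W ∧ ∃ x ∈ N'.carrier W, x ∉ N.carrier W := by
    by_contra! h
    exact hN'.not_ge (Subfun.le_of_indecomposable hHom h)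
  have hWl := hloc W hW
  have hrad : ∀ {V V' : E} (a : V' ⟶ V) (h : V ⟶ W),
      h ∈ nonSplit hWl hW.1 V → a ≫ h ∈ nonSplit hWl hW.1 V' := by
    intro V V' a h hh s hs
    exact hh (s ≫ a) (by rwa [Category.assoc])
  -- Nakayama: otherwise `x = n + h x` with `n` in `N` and `h` not invertible, so `1 - h` is
  -- invertible and `x` lies in `N`.
  have h1 : N.adjoin x (nonSplit hWl hW.1) hrad = N := by
    by_contra hne
    have hlt : N < N.adjoin x (nonSplit hWl hW.1) hrad :=
      lt_of_le_of_ne (N.le_adjoin x _ _) (Ne.symm hne)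
    have heq : N.adjoin x (nonSplit hWl hW.1) hrad = N' := by
      by_contra hne'
      exact hmin _ hlt (lt_of_le_of_ne (Subfun.adjoin_le hN'.le hx' _ _) hne')
    have hxm : x ∈ (N.adjoin x (nonSplit hWl hW.1) hrad).carrier W := heq ▸ hx'
    obtain ⟨n, hn, h, hh, hxe⟩ := hxm
    rcases hWl h (𝟙 W - h) (by abel) with hi | hi
    · exact hh (𝟙 W) (by rwa [Category.id_comp])
    · have hn' : restr M (𝟙 W - h) x = n := by
        rw [sub_eq_add_neg, restr_add, restr_neg, restr_id]
        nth_rewrite 1 [hxe]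
        abel
      have : x = restr M (inv (𝟙 W - h)) n := by
        rw [← hn', ← restr_comp, IsIso.inv_hom_id, restr_id]
      exact hx (this ▸ N.restr_mem _ _ hn)
  have h2 : N.adjoin x (fun _ ↦ ⊤) (fun _ _ _ ↦ trivial) = N' := by
    by_contra hne
    refine hmin (N.adjoin x (fun _ ↦ ⊤) (fun _ _ _ ↦ trivial)) ?_
      (lt_of_le_of_ne (Subfun.adjoin_le hN'.le hx' _ _) hne)
    refine lt_of_le_of_ne (N.le_adjoin x _ _) fun h ↦ hx ?_
    rw [h]
    exact ⟨0, zero_mem _, 𝟙 W, trivial, by simp⟩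
  refine hmax N' ⟨T ⊞ W, fun V hV y hy hy0 ↦ ?_⟩ hN'
  by_cases hyN : y ∈ N.carrier V
  · obtain ⟨r⟩ := hT V hV y hyN hy0
    exact ⟨⟨r.i ≫ biprod.inl, biprod.fst ≫ r.r, by simp⟩⟩
  · rw [← h2] at hy
    obtain ⟨n, hn, h, -, rfl⟩ := hy
    have hns : ¬ ∀ s : W ⟶ V, ¬ IsIso (s ≫ h) := by
      intro hh
      refine hyN ?_
      rw [← h1]
      exact ⟨n, hn, h, hh, rfl⟩
    push Not at hns
    obtain ⟨s, hs⟩ := hns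
    have hinv : inv (s ≫ h) ≫ s ≫ h = 𝟙 W := IsIso.inv_hom_id _
    -- This idempotent of `V` is nonzero, hence the identity, and `V` is a retract of `W`.
    rcases hV.eq_zero_or_eq_id (h ≫ inv (s ≫ h) ≫ s) (by
      simp only [Category.assoc]
      rw [reassoc_of% hinv]) with he | he
    · exfalso
      have : inv (s ≫ h) ≫ s ≫ (h ≫ inv (s ≫ h) ≫ s) ≫ h = 𝟙 W := by
        simp only [Category.assoc]
        rw [reassoc_of% hinv, hinv]
      rw [he] at this
      exact hW.1 ((IsZero.iff_id_eq_zero W).2 (by simpa using this.symm))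
    · exact ⟨⟨h ≫ biprod.inr, biprod.snd ≫ inv (s ≫ h) ≫ s, by simpa using he⟩⟩

end

end Support

/-! ### The values of `Coker E(-, g)` as `R`-modules; finite support gives finite length. -/

section CokerHom

variable {E : Type u} [Category.{v} E] [Preadditive E]

/-- The class of a morphism in `Coker E(-, g)`. -/
def cokerMk {Y Z : E} (g : Y ⟶ Z) {W : E} (f : W ⟶ Z) : (cokerHom g).obj.obj (op W) :=
  (QuotientAddGroup.mk f : (W ⟶ Z) ⧸ (Preadditive.rightComp W g).range)

variable {Y Z : E} (g : Y ⟶ Z)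

theorem cokerMk_surjective {W : E} (x : (cokerHom g).obj.obj (op W)) :
    ∃ f : W ⟶ Z, cokerMk g f = x :=
  QuotientAddGroup.mk_surjective x

theorem cokerMk_eq_zero_iff {W : E} (f : W ⟶ Z) : cokerMk g f = 0 ↔ ∃ k : W ⟶ Y, k ≫ g = f :=
  QuotientAddGroup.eq_zero_iff f

theorem cokerMk_add {W : E} (f f' : W ⟶ Z) :
    cokerMk g (f + f') = cokerMk g f + cokerMk g f' := rfl

theorem restr_cokerMk {W V : E} (a : V ⟶ W) (f : W ⟶ Z) :
    restr (cokerHom g) a (cokerMk g f) = cokerMk g (a ≫ f) := rfl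

variable (R : Type w) [CommRing R] [Linear R E]

/-- The value of `Coker E(-, g)` at `W`, as an `R`-module. -/
abbrev CokerModule {Y Z : E} (g : Y ⟶ Z) (W : E) : Type v :=
  (W ⟶ Z) ⧸ LinearMap.range (Linear.rightComp R W g)

theorem CokerModule.subsingleton_iff (W : E) :
    Subsingleton (CokerModule R g W) ↔ ∀ f : W ⟶ Z, ∃ k : W ⟶ Y, k ≫ g = f := by
  rw [Submodule.Quotient.subsingleton_iff, Submodule.eq_top_iff']
  rfl

theorem CokerModule.mk_eq_zero_iff {W : E} (f : W ⟶ Z) :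
    (Submodule.Quotient.mk f : CokerModule R g W) = 0 ↔ ∃ k : W ⟶ Y, k ≫ g = f :=
  Submodule.Quotient.mk_eq_zero _

/-- The map on cokernels induced by a commutative square. -/
def CokerModule.map {g : Y ⟶ Z} {Y' Z' : E} {g' : Y' ⟶ Z'} (u : Z ⟶ Z')
    (h : ∃ t : Y ⟶ Y', t ≫ g' = g ≫ u) (W : E) : CokerModule R g W →ₗ[R] CokerModule R g' W :=
  Submodule.mapQ _ _ (Linear.rightComp R W u) (by
    rintro _ ⟨k, rfl⟩
    obtain ⟨t, ht⟩ := h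
    refine ⟨k ≫ t, ?_⟩
    simp [ht])

theorem CokerModule.map_mk {g : Y ⟶ Z} {Y' Z' : E} {g' : Y' ⟶ Z'} (u : Z ⟶ Z')
    (h : ∃ t : Y ⟶ Y', t ≫ g' = g ≫ u) {W : E} (f : W ⟶ Z) :
    CokerModule.map R u h W (Submodule.Quotient.mk f) = Submodule.Quotient.mk (f ≫ u) := rfl

/-- The elements of a submodule of `Coker E(-, g)` at `T`, lifted to `E(T, Z)`. -/
def Subfun.lift (N : Subfun (cokerHom g)) (T : E) : Submodule R (T ⟶ Z) where
  carrier := {f | cokerMk g f ∈ N.carrier T}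
  zero_mem' := by
    change cokerMk g 0 ∈ N.carrier T
    rw [(cokerMk_eq_zero_iff g (0 : T ⟶ Z)).2 ⟨0, zero_comp⟩]
    exact zero_mem _
  add_mem' {f f'} hf hf' := by
    change cokerMk g (f + f') ∈ N.carrier T
    rw [cokerMk_add]
    exact add_mem hf hf'
  smul_mem' r f hf := by
    change cokerMk g (r • f) ∈ N.carrier T
    -- Scalars act through endomorphisms of `T`, so every submodule is automatically `R`-linear.
    have : r • f = (r • 𝟙 T) ≫ f := by simp
    rw [this, ← restr_cokerMk]
    exact N.restr_mem _ _ hf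

theorem Subfun.range_le_lift (N : Subfun (cokerHom g)) (T : E) :
    LinearMap.range (Linear.rightComp R T g) ≤ N.lift g R T := by
  intro f hf
  change cokerMk g f ∈ N.carrier T
  rw [(cokerMk_eq_zero_iff g f).2 hf]
  exact zero_mem _

/-- Evaluation at `T` is strictly increasing on submodules, because every indecomposable in the
support is a retract of `T`; both chain conditions are thus inherited from the value at `T`. -/
theorem hasFiniteLength_cokerHom [IsNoetherianRing R] [HasBinaryBiproducts E]
    (hHom : HomNoetherian R E) (T : E)
    (hT : ∀ W, Indecomposable W → ∀ f : W ⟶ Z, (¬ ∃ k : W ⟶ Y, k ≫ g = f) →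
      Nonempty (Retract W T))
    [IsNoetherian R (CokerModule R g T)] [IsArtinian R (CokerModule R g T)] :
    HasFiniteLength (cokerHom g) := by
  let φ : Subfun (cokerHom g) → Submodule R (CokerModule R g T) :=
    fun N ↦ (N.lift g R T).map (Submodule.mkQ _)
  have hφ : StrictMono φ := by
    intro N N' hlt
    refine lt_of_le_of_ne (Submodule.map_mono fun f hf ↦ hlt.le T hf) fun heq ↦ ?_
    have hTT : N'.carrier T ≤ N.carrier T := by
      intro y hy
      obtain ⟨f, rfl⟩ := cokerMk_surjective g y
      have hf : f ∈ ((N.lift g R T).map (Submodule.mkQ _)).comap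
          (Submodule.mkQ (LinearMap.range (Linear.rightComp R T g))) := by
        change _ ∈ φ N
        rw [heq]
        exact Submodule.mem_map_of_mem hy
      rw [Submodule.comap_map_mkQ, sup_eq_right.2 (Subfun.range_le_lift g R N T)] at hf
      exact hf
    refine hlt.not_ge (Subfun.le_of_indecomposable hHom fun W hW y hy ↦ ?_)
    obtain ⟨f, rfl⟩ := cokerMk_surjective g y
    by_cases hf : ∃ k : W ⟶ Y, k ≫ g = f
    · rw [(cokerMk_eq_zero_iff g f).2 hf]
      exact zero_mem _
    · obtain ⟨r⟩ := hT W hW f hf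
      have := N.restr_mem r.i _ (hTT (N'.restr_mem r.r _ hy))
      rwa [← restr_comp, r.retract, restr_id] at this
  have := hφ.wellFoundedGT
  have := hφ.wellFoundedLT
  exact hasFiniteLength_of_wellFounded _

end CokerHom

/-! ### Elementary properties of conflations. -/

namespace ExactStructure

variable {E : Type u} [Category.{v} E] [Preadditive E] [HasZeroObject E] [HasBinaryBiproducts E]
  {𝓔 : ExactStructure E}

section Conflation

variable {X Y Z : E} {f : X ⟶ Y} {g : Y ⟶ Z} {w : f ≫ g = 0}

theorem mono_of_conflation (h : 𝓔.Conflation (ShortComplex.mk f g w)) : Mono f := by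
  obtain ⟨hl⟩ := 𝓔.isKernel _ h
  exact mono_of_isLimit_fork hl

theorem epi_of_conflation (h : 𝓔.Conflation (ShortComplex.mk f g w)) : Epi g := by
  obtain ⟨hl⟩ := 𝓔.isCokernel _ h
  exact epi_of_isColimit_cofork hl

theorem exists_lift_of_conflation (h : 𝓔.Conflation (ShortComplex.mk f g w)) {W : E} (k : W ⟶ Y)
    (hk : k ≫ g = 0) : ∃ t : W ⟶ X, t ≫ f = k := by
  obtain ⟨hl⟩ := 𝓔.isKernel _ h
  exact ⟨_, (KernelFork.IsLimit.lift' hl k hk).2⟩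

theorem exists_desc_of_conflation (h : 𝓔.Conflation (ShortComplex.mk f g w)) {W : E} (k : Y ⟶ W)
    (hk : f ≫ k = 0) : ∃ t : Z ⟶ W, g ≫ t = k := by
  obtain ⟨hl⟩ := 𝓔.isCokernel _ h
  exact ⟨_, (CokernelCofork.IsColimit.desc' hl k hk).2⟩

theorem isDeflation_of_conflation (h : 𝓔.Conflation (ShortComplex.mk f g w)) : 𝓔.IsDeflation g :=
  ⟨X, f, w, h⟩

theorem isInflation_of_conflation (h : 𝓔.Conflation (ShortComplex.mk f g w)) : 𝓔.IsInflation f :=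
  ⟨Z, g, w, h⟩

end Conflation

/-- A kernel of a deflation completes it to a conflation. -/
theorem conflation_of_isDeflation {X Y Z : E} {f : X ⟶ Y} {g : Y ⟶ Z} (w : f ≫ g = 0)
    (hg : 𝓔.IsDeflation g) (hf : Mono f)
    (hker : ∀ (W : E) (k : W ⟶ Y), k ≫ g = 0 → ∃ t : W ⟶ X, t ≫ f = k) :
    𝓔.Conflation (ShortComplex.mk f g w) := by
  obtain ⟨X', f', w', h⟩ := hg
  have := mono_of_conflation h
  obtain ⟨a, ha⟩ := hker _ f' w'
  obtain ⟨b, hb⟩ := exists_lift_of_conflation h f w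
  let e : X' ≅ X := ⟨a, b, by rw [← cancel_mono f', Category.assoc, hb, ha, Category.id_comp],
    by rw [← cancel_mono f, Category.assoc, ha, hb, Category.id_comp]⟩
  exact 𝓔.of_iso (ShortComplex.mk f' g w') _ ⟨ShortComplex.isoMk e (Iso.refl _) (Iso.refl _) (by simpa [e] using ha)
    (by simp)⟩ h

/-- Any pullback of a deflation is a deflation. -/
theorem isDeflation_of_isPullback {Q W Y Z : E} {f' : Q ⟶ Y} {p' : Q ⟶ W} {p : Y ⟶ Z} {f : W ⟶ Z}
    (h : IsPullback f' p' p f) (hp : 𝓔.IsDeflation p) : 𝓔.IsDeflation p' := by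
  obtain ⟨Q', f'', p'', h', X, i, wi, hi⟩ := 𝓔.deflation_pullback p f hp
  let e := h'.isoIsPullback _ _ h
  refine ⟨X, i ≫ e.hom, by simpa [e] using wi,
    𝓔.of_iso (ShortComplex.mk i p'' wi) _ ⟨ShortComplex.isoMk (Iso.refl _) e
    (Iso.refl _) (by simp) (by simp [e])⟩ hi⟩

/-! ### AR conflations make the values of `Coker E(-, p)` artinian. -/

section FiniteLength

variable {R : Type w} [CommRing R] [IsLocalRing R] [IsNoetherianRing R] [Linear R E]

/-- A morphism `f : W ⟶ Z` that does not factor through `p` yields, after pushing out the class of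
a conflation along the induced morphism, the class of a given AR conflation. -/
theorem exists_comp_eq_of_not_factors {K P W A F X Y Z : E} (hW : HasLocalEnd W)
    {k : K ⟶ P} {q : P ⟶ W} {wk : k ≫ q = 0}
    {a : A ⟶ F} {b : F ⟶ W} {wa : a ≫ b = 0} (ha : 𝓔.Conflation (ShortComplex.mk a b wa))
    (hb : RightAlmostSplit b)
    {i : X ⟶ Y} {p : Y ⟶ Z} {wi : i ≫ p = 0} (hi : 𝓔.Conflation (ShortComplex.mk i p wi))
    {q' : P ⟶ F} (hq' : q' ≫ b = q) {x : K ⟶ A} (hx : x ≫ a = k ≫ q')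
    {f : W ⟶ Z} {φ : P ⟶ Y} (hφ : φ ≫ p = q ≫ f) {ω : K ⟶ X} (hω : ω ≫ i = k ≫ φ)
    (hf : ¬ ∃ t : W ⟶ Y, t ≫ p = f) :
    ∃ (h : X ⟶ A) (y : P ⟶ A), x - ω ≫ h = k ≫ y := by
  obtain ⟨Q, f', p', hpb, -⟩ := 𝓔.deflation_pullback p f (isDeflation_of_conflation hi)
  -- A section of the pulled-back deflation would factor `f` through `p`; so it is radical and
  -- factors through `b`.
  have hrad : InJacobsonRadical p' := inJacobsonRadical_of_not_split hW p' fun s hs ↦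
    hf ⟨s ≫ f', by rw [Category.assoc, hpb.w, reassoc_of% hs]⟩
  obtain ⟨u, hu⟩ := hb.2.2 _ p' hrad
  have := mono_of_conflation ha
  let i' : X ⟶ Q := hpb.lift i 0 (by rw [wi, zero_comp])
  have hi'1 : i' ≫ f' = i := hpb.lift_fst _ _ _
  have hi'2 : i' ≫ p' = 0 := hpb.lift_snd _ _ _
  obtain ⟨h, hh⟩ := exists_lift_of_conflation ha (i' ≫ u) (by rw [Category.assoc, hu, hi'2])
  let ψ : P ⟶ Q := hpb.lift φ q hφ
  have hψ1 : ψ ≫ f' = φ := hpb.lift_fst _ _ _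
  have hψ2 : ψ ≫ p' = q := hpb.lift_snd _ _ _
  have hkψ : k ≫ ψ = ω ≫ i' := by
    apply hpb.hom_ext
    · rw [Category.assoc, Category.assoc, hψ1, hi'1, hω]
    · rw [Category.assoc, Category.assoc, hψ2, hi'2, wk, comp_zero]
  -- Both `q'` and `ψ ≫ u` lift `q` through `b`, so they differ by a morphism into `A`.
  obtain ⟨y, hy⟩ := exists_lift_of_conflation ha (q' - ψ ≫ u)
    (by rw [Preadditive.sub_comp, Category.assoc, hu, hψ2, hq', sub_self])
  refine ⟨h, y, ?_⟩
  rw [← cancel_mono a, Preadditive.sub_comp, Category.assoc, Category.assoc, hx, hh, hy,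
    Preadditive.comp_sub, reassoc_of% hkψ]

/-- Relative to a projective presentation, the class of an AR conflation is nonzero. -/
theorem not_factors_of_rightAlmostSplit {K P W A F : E}
    {k : K ⟶ P} {q : P ⟶ W} {wk : k ≫ q = 0} (hk : 𝓔.Conflation (ShortComplex.mk k q wk))
    {a : A ⟶ F} {b : F ⟶ W} (wa : a ≫ b = 0) (hb : RightAlmostSplit b)
    {q' : P ⟶ F} (hq' : q' ≫ b = q) {x : K ⟶ A} (hx : x ≫ a = k ≫ q') (y : P ⟶ A) :
    k ≫ y ≠ x := by
  intro hy
  have := epi_of_conflation hk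
  obtain ⟨t, ht⟩ := exists_desc_of_conflation hk (q' - y ≫ a) (by
    rw [Preadditive.comp_sub, reassoc_of% hy, hx, sub_self])
  refine hb.2.1.not_split hb.1.1 t ?_
  rw [← cancel_epi q, reassoc_of% ht, Preadditive.sub_comp, Category.assoc, wa, hq']
  simp

theorem isArtinian_cokerModule_of_indecomposable (hHom : HomNoetherian R E)
    (hP : 𝓔.HasEnoughProjectives) (hAR : 𝓔.HasRightARConflations)
    {X Y Z : E} {i : X ⟶ Y} {p : Y ⟶ Z} {wi : i ≫ p = 0}
    (hi : 𝓔.Conflation (ShortComplex.mk i p wi)) {W : E} (hW : Indecomposable W)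
    (hWl : HasLocalEnd W) : IsArtinian R (CokerModule R p W) := by
  by_cases hWP : 𝓔.IsProjective W
  · have : Subsingleton (CokerModule R p W) :=
      (CokerModule.subsingleton_iff p R W).2 (hWP p (isDeflation_of_conflation hi))
    infer_instance
  obtain ⟨A, F, a, b, wa, ha, -, hb⟩ := hAR W hW hWP
  obtain ⟨P, q, hPp, K, k, wk, hk⟩ := hP W
  obtain ⟨q', hq'⟩ := hPp b (isDeflation_of_conflation ha) q
  obtain ⟨x, hx⟩ := exists_lift_of_conflation ha (k ≫ q') (by rw [Category.assoc, hq', wk])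
  have := hHom K A
  have := hHom W Z
  set m := IsLocalRing.maximalIdeal R
  -- The quotient by `B` plays the role of `Ext¹(W, A)`, with `x` representing the AR conflation.
  let B : Submodule R (K ⟶ A) := LinearMap.range (Linear.leftComp R A k)
  have hxB : B.mkQ x ≠ 0 := by
    rw [Submodule.mkQ_apply, Ne, Submodule.Quotient.mk_eq_zero]
    rintro ⟨y, hy⟩
    exact not_factors_of_rightAlmostSplit hk wa hb hq' hx y hy
  obtain ⟨n, hn⟩ : ∃ n : ℕ, B.mkQ x ∉ m ^ n • (⊤ : Submodule R ((K ⟶ A) ⧸ B)) := by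
    by_contra! h
    refine hxB ?_
    rw [← Submodule.mem_bot R, ← Ideal.iInf_pow_smul_eq_bot_of_isLocalRing m
      (Ideal.IsPrime.ne_top inferInstance), Submodule.mem_iInf]
    exact h
  refine isArtinian_of_pow_smul_eq_bot n ?_
  -- The representative `ω` of the pull-back along `f` can be chosen linearly in `f`, hence inside
  -- `m ^ n Hom(K, X)`.
  have hcl : ∀ f ∈ m ^ n • (⊤ : Submodule R (W ⟶ Z)), ∃ (φ : P ⟶ Y) (ω : K ⟶ X),
      φ ≫ p = q ≫ f ∧ ω ≫ i = k ≫ φ ∧ ω ∈ m ^ n • (⊤ : Submodule R (K ⟶ X)) := by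
    intro f hf
    refine Submodule.smul_induction_on hf (fun r hr f _ ↦ ?_) (fun f f' hf hf' ↦ ?_)
    · obtain ⟨φ, hφ⟩ := hPp p (isDeflation_of_conflation hi) (q ≫ f)
      obtain ⟨ω, hω⟩ := exists_lift_of_conflation hi (k ≫ φ)
        (by rw [Category.assoc, hφ, reassoc_of% wk, zero_comp])
      exact ⟨r • φ, r • ω, by simp [hφ], by simp [hω], Submodule.smul_mem_smul hr trivial⟩
    · obtain ⟨φ, ω, h1, h2, h3⟩ := hf
      obtain ⟨φ', ω', h1', h2', h3'⟩ := hf'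
      exact ⟨φ + φ', ω + ω', by simp [h1, h1'], by simp [h2, h2'], add_mem h3 h3'⟩
  have htop : (⊤ : Submodule R (CokerModule R p W)) = (⊤ : Submodule R (W ⟶ Z)).map
      (Submodule.mkQ _) := by
    rw [Submodule.map_top, Submodule.range_mkQ]
  rw [htop, ← Submodule.map_smul'', eq_bot_iff,
    Submodule.map_le_iff_le_comap]
  intro f hf
  rw [Submodule.mem_comap, Submodule.mem_bot, Submodule.mkQ_apply, Submodule.Quotient.mk_eq_zero]
  obtain ⟨φ, ω, h1, h2, h3⟩ := hcl f hf
  by_contra hcon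
  obtain ⟨h, y, hy⟩ := exists_comp_eq_of_not_factors hWl (wk := wk) ha hb hi hq' hx h1 h2 hcon
  refine hn ?_
  have hxe : B.mkQ x = B.mkQ (ω ≫ h) := by
    rw [Submodule.mkQ_apply, Submodule.mkQ_apply, Submodule.Quotient.eq, hy]
    exact ⟨y, rfl⟩
  rw [hxe]
  have : ∀ ω ∈ m ^ n • (⊤ : Submodule R (K ⟶ X)),
      (B.mkQ ∘ₗ Linear.rightComp R K h) ω ∈ m ^ n • (⊤ : Submodule R ((K ⟶ A) ⧸ B)) := by
    intro ω hω
    have h4 := Submodule.mem_map_of_mem (f := B.mkQ ∘ₗ Linear.rightComp R K h) hω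
    rw [Submodule.map_smul''] at h4
    exact Submodule.smul_mono le_rfl le_top h4
  exact this ω h3

theorem isArtinian_cokerModule (hHom : HomNoetherian R E)
    (hloc : ∀ W : E, Indecomposable W → HasLocalEnd W)
    (hP : 𝓔.HasEnoughProjectives) (hAR : 𝓔.HasRightARConflations)
    {X Y Z : E} {i : X ⟶ Y} {p : Y ⟶ Z} {wi : i ≫ p = 0}
    (hi : 𝓔.Conflation (ShortComplex.mk i p wi)) (W : E) : IsArtinian R (CokerModule R p W) := by
  refine hHom.induction_indecomposable (fun W ↦ IsArtinian R (CokerModule R p W)) ?_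
    (fun W hW ↦ isArtinian_cokerModule_of_indecomposable hHom hP hAR hi hW (hloc W hW)) ?_ W
  · intro W hW
    have : Subsingleton (CokerModule R p W) :=
      (CokerModule.subsingleton_iff p R W).2 fun f ↦ ⟨0, hW.eq_of_src _ _⟩
    infer_instance
  · intro W A B e hA hB
    have hle : ∀ {V : E} (s : V ⟶ W), LinearMap.range (Linear.rightComp R W p) ≤
        (LinearMap.range (Linear.rightComp R V p)).comap (Linear.leftComp R Z s) := by
      rintro V s _ ⟨t, rfl⟩
      exact ⟨s ≫ t, Category.assoc _ _ _⟩
    let r : ∀ {V : E} (s : V ⟶ W), CokerModule R p W →ₗ[R] CokerModule R p V :=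
      fun s ↦ Submodule.mapQ _ _ _ (hle s)
    refine isArtinian_of_injective ((r (biprod.inl ≫ e.inv)).prod (r (biprod.inr ≫ e.inv))) ?_
    rw [injective_iff_map_eq_zero]
    intro y hy
    obtain ⟨f, rfl⟩ := Submodule.Quotient.mk_surjective _ y
    obtain ⟨h1, h2⟩ := Prod.ext_iff.1 hy
    obtain ⟨t1, h1⟩ := (Submodule.Quotient.mk_eq_zero _).1 h1
    obtain ⟨t2, h2⟩ := (Submodule.Quotient.mk_eq_zero _).1 h2
    have h1 : t1 ≫ p = (biprod.inl ≫ e.inv) ≫ f := h1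
    have h2 : t2 ≫ p = (biprod.inr ≫ e.inv) ≫ f := h2
    refine (Submodule.Quotient.mk_eq_zero _).2 ⟨e.hom ≫ biprod.desc t1 t2, ?_⟩
    change (e.hom ≫ biprod.desc t1 t2) ≫ p = f
    rw [Category.assoc, ← cancel_epi e.inv, e.inv_hom_id_assoc]
    ext
    · simpa using h1
    · simpa using h2

end FiniteLength

end ExactStructure

namespace ExactStructure

variable {E : Type u} [Category.{v} E] [Preadditive E] [HasZeroObject E] [HasBinaryBiproducts E]
  {𝓔 : ExactStructure E}

/-! ### Projectives, the stable category and projective dimension. -/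

section Projective

theorem IsProjective.of_comp_eq_id {P V : E} (hP : 𝓔.IsProjective P) (a : V ⟶ P) (b : P ⟶ V)
    (hab : a ≫ b = 𝟙 V) : 𝓔.IsProjective V := by
  intro Y Z p hp f
  obtain ⟨k, hk⟩ := hP p hp (b ≫ f)
  exact ⟨a ≫ k, by rw [Category.assoc, hk, reassoc_of% hab]⟩

theorem IsProjective.biprod {P Q : E} (hP : 𝓔.IsProjective P) (hQ : 𝓔.IsProjective Q) :
    𝓔.IsProjective (P ⊞ Q) := by
  intro Y Z p hp f
  obtain ⟨k, hk⟩ := hP p hp (biprod.inl ≫ f)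
  obtain ⟨l, hl⟩ := hQ p hp (biprod.inr ≫ f)
  exact ⟨biprod.desc k l, by ext <;> simp [hk, hl]⟩

theorem isProjective_of_isZero {V : E} (hV : IsZero V) : 𝓔.IsProjective V :=
  fun _ _ _ _ _ ↦ ⟨0, hV.eq_of_src _ _⟩

variable (𝓔) in
instance : Congruence 𝓔.stableRel where
  equivalence := by
    intro X Y
    obtain ⟨O, hO⟩ := HasZeroObject.zero (C := E)
    refine ⟨fun f ↦ ⟨O, 0, 0, isProjective_of_isZero hO, by simp⟩, ?_, ?_⟩
    · rintro f g ⟨P, a, b, hP, h⟩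
      exact ⟨P, -a, b, hP, by rw [Preadditive.neg_comp, ← h]; abel⟩
    · rintro f g h ⟨P, a, b, hP, h1⟩ ⟨Q, c, d, hQ, h2⟩
      refine ⟨P ⊞ Q, biprod.lift a c, biprod.desc b d, hP.biprod hQ, ?_⟩
      rw [biprod.lift_desc, ← h1, ← h2]
      abel
  comp_left := by
    rintro X Y Z f g g' ⟨P, a, b, hP, h⟩
    exact ⟨P, f ≫ a, b, hP, by rw [← Preadditive.comp_sub, h, Category.assoc]⟩
  comp_right := by
    rintro X Y Z f f' g ⟨P, a, b, hP, h⟩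
    exact ⟨P, a, b ≫ g, hP, by rw [← Preadditive.sub_comp, h, Category.assoc]⟩

theorem isProjective_of_isZero_stable {K : E} (hK : IsZero (𝓔.toStable.obj K)) :
    𝓔.IsProjective K := by
  obtain ⟨P, a, b, hP, h⟩ := (Quotient.functor_map_eq_iff 𝓔.stableRel (𝟙 K) 0).1
    (hK.eq_of_src _ _)
  exact hP.of_comp_eq_id a b (by rw [← h, sub_zero])

variable (𝓔) in
/-- `X` has a projective resolution of length at most `n`. -/
def ProjDimLE : ℕ → E → Prop
  | 0, X => 𝓔.IsProjective X
  | n + 1, X => ∃ (L P : E) (i : L ⟶ P) (p : P ⟶ X) (w : i ≫ p = 0),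
      𝓔.Conflation (ShortComplex.mk i p w) ∧ 𝓔.IsProjective P ∧ ProjDimLE n L

theorem HasFiniteProjectiveDimension.exists_projDimLE {X : E}
    (h : 𝓔.HasFiniteProjectiveDimension X) : ∃ n, 𝓔.ProjDimLE n X := by
  obtain ⟨n, K, hK, hK0⟩ := h
  refine ⟨n, ?_⟩
  induction n generalizing X with
  | zero =>
    obtain rfl : K = X := hK
    exact isProjective_of_isZero_stable hK0
  | succ n ih =>
    obtain ⟨L, P, i, p, w, hc, hP, hL⟩ := hK
    exact ⟨L, P, i, p, w, hc, hP, ih hL⟩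

/-- The direct sum of a conflation with the identity of `Q`. -/
theorem conflation_biprod {L P X : E} {i : L ⟶ P} {p : P ⟶ X} {w : i ≫ p = 0}
    (h : 𝓔.Conflation (ShortComplex.mk i p w)) (Q : E) :
    𝓔.Conflation (ShortComplex.mk (i ≫ biprod.inl : L ⟶ P ⊞ Q) (biprod.map p (𝟙 Q))
      (by simp [reassoc_of% w])) := by
  have := mono_of_conflation h
  -- The new second map is a pull-back of `p`, hence a deflation.
  have hpb : IsPullback (biprod.fst : P ⊞ Q ⟶ P) (biprod.map p (𝟙 Q)) p biprod.fst := by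
    refine ⟨⟨by simp⟩, ⟨PullbackCone.IsLimit.mk _
      (fun s ↦ biprod.lift s.fst (s.snd ≫ biprod.snd)) (fun s ↦ by simp) (fun s ↦ ?_)
      (fun s m h1 h2 ↦ ?_)⟩⟩
    · ext
      · simp [s.condition]
      · simp
    · ext
      · simp [← h1]
      · simp [← h2]
  refine conflation_of_isDeflation _
    (isDeflation_of_isPullback hpb (isDeflation_of_conflation h)) (mono_comp _ _) ?_
  intro W k hk
  obtain ⟨t, ht⟩ := exists_lift_of_conflation h (k ≫ biprod.fst) (by
    have := congrArg (· ≫ biprod.fst) hk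
    simpa using this)
  refine ⟨t, ?_⟩
  have h2 := congrArg (· ≫ biprod.snd) hk
  ext
  · simp [ht]
  · simpa using h2.symm

theorem ProjDimLE.biprod {n : ℕ} {X Q : E} (hX : 𝓔.ProjDimLE n X) (hQ : 𝓔.IsProjective Q) :
    𝓔.ProjDimLE n (X ⊞ Q) := by
  cases n with
  | zero => exact IsProjective.biprod hX hQ
  | succ n =>
    obtain ⟨L, P, i, p, w, hc, hP, hL⟩ := hX
    exact ⟨L, P ⊞ Q, _, _, _, conflation_biprod hc Q, hP.biprod hQ, hL⟩

end Projective

/-! ### Rotation of conflations and the case of finite projective dimension. -/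

section Rotation

variable {X Y Z L P : E} {f : X ⟶ Y} {g : Y ⟶ Z} {w : f ≫ g = 0}
  {k : L ⟶ P} {p : P ⟶ Z} {wk : k ≫ p = 0} {l : P ⟶ Y}

/-- The lift `l` of `p` through `g` splits the pull-back of the conflation along `p`. -/
theorem isPullback_rotate (h : 𝓔.Conflation (ShortComplex.mk f g w)) (hl : l ≫ g = p) :
    IsPullback (biprod.snd : X ⊞ P ⟶ P) (biprod.desc f l) p g := by
  have := mono_of_conflation h
  have hex : ∀ s : PullbackCone p g, ∃ t : s.pt ⟶ X, t ≫ f = s.snd - s.fst ≫ l := fun s ↦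
    exists_lift_of_conflation h _ (by
      rw [Preadditive.sub_comp, Category.assoc, hl, s.condition, sub_self])
  choose t ht using hex
  refine ⟨⟨by ext <;> simp [hl, w]⟩, ⟨PullbackCone.IsLimit.mk _
    (fun s ↦ biprod.lift (t s) s.fst) (fun s ↦ by simp)
    (fun s ↦ by simp [ht]) (fun s m h1 h2 ↦ ?_)⟩⟩
  ext
  · rw [biprod.lift_fst, ← cancel_mono f, ht, ← h1, ← h2]
    simp [biprod.desc_eq]
  · rw [biprod.lift_snd, h1]

/-- The rotation `0 ⟶ L ⟶ X ⊞ P ⟶ Y ⟶ 0` of a conflation `0 ⟶ X ⟶ Y ⟶ Z ⟶ 0` along a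
presentation `0 ⟶ L ⟶ P ⟶ Z ⟶ 0`. -/
theorem exists_conflation_rotate (h : 𝓔.Conflation (ShortComplex.mk f g w))
    (hk : 𝓔.Conflation (ShortComplex.mk k p wk)) (hl : l ≫ g = p) :
    ∃ (j : L ⟶ X ⊞ P) (wj : j ≫ biprod.desc f l = 0),
      𝓔.Conflation (ShortComplex.mk j (biprod.desc f l) wj) := by
  have hpb := isPullback_rotate h hl
  have := mono_of_conflation hk
  let j : L ⟶ X ⊞ P := hpb.lift k 0 (by rw [wk, zero_comp])
  have hj1 : j ≫ biprod.snd = k := hpb.lift_fst _ _ _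
  have hj2 : j ≫ biprod.desc f l = 0 := hpb.lift_snd _ _ _
  refine ⟨j, hj2, conflation_of_isDeflation _
    (isDeflation_of_isPullback hpb (isDeflation_of_conflation hk)) ?_ fun W m hm ↦ ?_⟩
  · have : Mono (j ≫ biprod.snd) := by rwa [hj1]
    exact mono_of_mono j biprod.snd
  · obtain ⟨t, ht⟩ := exists_lift_of_conflation hk (m ≫ biprod.snd) (by
      rw [Category.assoc, hpb.w, reassoc_of% hm, zero_comp])
    refine ⟨t, hpb.hom_ext ?_ ?_⟩
    · rw [Category.assoc, hj1, ht]
    · rw [Category.assoc, hj2, hm, comp_zero]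

/-- Composition with `g` and the identity of `Z` induce a short exact sequence of cokernels;
exactness on the left is the pull-back property. -/
theorem length_rotate (R : Type w) [CommRing R] [Linear R E]
    (h : 𝓔.Conflation (ShortComplex.mk f g w)) (hl : l ≫ g = p) (W : E) :
    Module.length R (CokerModule R p W) =
      Module.length R (CokerModule R (biprod.desc f l) W) +
        Module.length R (CokerModule R g W) := by
  have hpb := isPullback_rotate h hl
  refine Module.length_eq_add_of_exact
    (CokerModule.map R g ⟨biprod.snd, hpb.w⟩ W)
    (CokerModule.map R (𝟙 Z) ⟨l, by rw [hl, Category.comp_id]⟩ W) ?_ ?_ ?_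
  · rw [injective_iff_map_eq_zero]
    intro y hy
    obtain ⟨y, rfl⟩ := Submodule.Quotient.mk_surjective _ y
    rw [CokerModule.map_mk, CokerModule.mk_eq_zero_iff] at hy
    obtain ⟨t, ht⟩ := hy
    rw [CokerModule.mk_eq_zero_iff]
    exact ⟨hpb.lift t y ht, hpb.lift_snd _ _ _⟩
  · intro y
    obtain ⟨y, rfl⟩ := Submodule.Quotient.mk_surjective _ y
    exact ⟨Submodule.Quotient.mk y, by rw [CokerModule.map_mk, Category.comp_id]⟩
  · intro y
    obtain ⟨y, rfl⟩ := Submodule.Quotient.mk_surjective _ y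
    rw [CokerModule.map_mk, CokerModule.mk_eq_zero_iff, Category.comp_id]
    constructor
    · rintro ⟨t, rfl⟩
      exact ⟨Submodule.Quotient.mk t, CokerModule.map_mk ..⟩
    · rintro ⟨t, ht⟩
      obtain ⟨t, rfl⟩ := Submodule.Quotient.mk_surjective _ t
      rw [CokerModule.map_mk, ← sub_eq_zero, ← Submodule.Quotient.mk_sub,
        CokerModule.mk_eq_zero_iff] at ht
      obtain ⟨s, hs⟩ := ht
      exact ⟨t - s ≫ l, by rw [Preadditive.sub_comp, Category.assoc, hl, hs]; abel⟩

theorem length_cokerModule_eq_zero (R : Type w) [CommRing R] [Linear R E]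
    (hZ : 𝓔.IsProjective Z) (h : 𝓔.Conflation (ShortComplex.mk f g w)) (W : E) :
    Module.length R (CokerModule R g W) = 0 := by
  refine Module.length_eq_zero_iff.2 ((CokerModule.subsingleton_iff _ R W).2 fun z ↦ ?_)
  obtain ⟨s, hs⟩ := hZ g (isDeflation_of_conflation h) (𝟙 Z)
  exact ⟨z ≫ s, by rw [Category.assoc, hs, Category.comp_id]⟩

/-- In finite projective dimension the length of `Coker E(-, g)` at `W` only depends on the terms
of the conflation. -/
theorem length_cokerModule_eq (R : Type w) [CommRing R] [Linear R E] (W : E)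
    (hfin : ∀ {X Y Z : E} {f : X ⟶ Y} {g : Y ⟶ Z} {w : f ≫ g = 0},
      𝓔.Conflation (ShortComplex.mk f g w) → Module.length R (CokerModule R g W) ≠ ⊤)
    {a b c : ℕ} {X Y Z : E} (hX : 𝓔.ProjDimLE a X) (hY : 𝓔.ProjDimLE b Y) (hZ : 𝓔.ProjDimLE c Z)
    {f₁ f₂ : X ⟶ Y} {g₁ g₂ : Y ⟶ Z} {w₁ : f₁ ≫ g₁ = 0} {w₂ : f₂ ≫ g₂ = 0}
    (h₁ : 𝓔.Conflation (ShortComplex.mk f₁ g₁ w₁)) (h₂ : 𝓔.Conflation (ShortComplex.mk f₂ g₂ w₂)) :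
    Module.length R (CokerModule R g₁ W) = Module.length R (CokerModule R g₂ W) := by
  -- The rotated conflation has terms `L`, `X ⊞ P`, `Y`, with bounds `c`, `a`, `b` where `Z` had `c
  -- + 1`: the total drops by one.
  induction hn : a + b + c generalizing a b c X Y Z with
  | zero =>
    obtain rfl : c = 0 := by omega
    rw [length_cokerModule_eq_zero R hZ h₁, length_cokerModule_eq_zero R hZ h₂]
  | succ n ih =>
    cases c with
    | zero => rw [length_cokerModule_eq_zero R hZ h₁, length_cokerModule_eq_zero R hZ h₂]
    | succ c =>
      obtain ⟨L, P, k, p, wk, hk, hP, hL⟩ := hZ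
      obtain ⟨l₁, hl₁⟩ := hP g₁ (isDeflation_of_conflation h₁) p
      obtain ⟨l₂, hl₂⟩ := hP g₂ (isDeflation_of_conflation h₂) p
      obtain ⟨_, _, hr₁⟩ := exists_conflation_rotate h₁ hk hl₁
      obtain ⟨_, _, hr₂⟩ := exists_conflation_rotate h₂ hk hl₂
      have e₁ := length_rotate R h₁ hl₁ W
      have e₂ := length_rotate R h₂ hl₂ W
      rw [ih hL (hX.biprod hP) hY hr₁ hr₂ (by omega)] at e₁
      exact ENat.add_right_injective_of_ne_top (hfin hr₂) (e₁.symm.trans e₂)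

end Rotation

end ExactStructure

/-- An additive functor that is nonzero at `S` is nonzero at some indecomposable summand of `S`. -/
theorem exists_indecomposable_retract {E : Type u} [Category.{v} E] [Preadditive E]
    [HasBinaryBiproducts E] {R : Type w} [CommRing R] [IsNoetherianRing R] [Linear R E]
    (hHom : HomNoetherian R E) {Y Z : E} (g : Y ⟶ Z) (S : E) (z : S ⟶ Z)
    (hz : ¬ ∃ k : S ⟶ Y, k ≫ g = z) :
    ∃ V, Indecomposable V ∧ Nonempty (Retract V S) ∧ ∃ z : V ⟶ Z, ¬ ∃ k : V ⟶ Y, k ≫ g = z := by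
  revert z
  refine hHom.induction_indecomposable (fun S ↦ ∀ z : S ⟶ Z, (¬ ∃ k : S ⟶ Y, k ≫ g = z) →
    ∃ V, Indecomposable V ∧ Nonempty (Retract V S) ∧
      ∃ z : V ⟶ Z, ¬ ∃ k : V ⟶ Y, k ≫ g = z) ?_ ?_ ?_ S
  · intro X hX z hz
    exact absurd ⟨0, hX.eq_of_src _ _⟩ hz
  · intro X hX z hz
    exact ⟨X, hX, ⟨Retract.refl X⟩, z, hz⟩
  · intro X A B e hA hB z hz
    by_cases hz1 : ∃ k : A ⟶ Y, k ≫ g = biprod.inl ≫ e.inv ≫ z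
    · by_cases hz2 : ∃ k : B ⟶ Y, k ≫ g = biprod.inr ≫ e.inv ≫ z
      · obtain ⟨k1, hk1⟩ := hz1
        obtain ⟨k2, hk2⟩ := hz2
        refine absurd ⟨e.hom ≫ biprod.desc k1 k2, ?_⟩ hz
        rw [Category.assoc, ← cancel_epi e.inv, e.inv_hom_id_assoc]
        ext
        · simpa using hk1
        · simpa using hk2
      · obtain ⟨V, hV, ⟨r⟩, hz⟩ := hB _ hz2
        exact ⟨V, hV, ⟨⟨r.i ≫ biprod.inr ≫ e.inv, e.hom ≫ biprod.snd ≫ r.r, by simp⟩⟩, hz⟩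
    · obtain ⟨V, hV, ⟨r⟩, hz⟩ := hA _ hz1
      exact ⟨V, hV, ⟨⟨r.i ≫ biprod.inl ≫ e.inv, e.hom ≫ biprod.fst ≫ r.r, by simp⟩⟩, hz⟩

namespace ExactStructure

variable {E : Type u} [Category.{v} E] [Preadditive E] [HasZeroObject E] [HasBinaryBiproducts E]
  {𝓔 : ExactStructure E}

/-! ### Stable Hom modules and the Frobenius case. -/

section Frobenius

/-- In a Frobenius category, if `Coker E(-, g)` vanishes at the cosyzygy `S` of `W`, then a morphism
`W ⟶ X` becoming stably zero in `Y` is stably zero. -/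
theorem exists_factor_of_comp_factors (hPI : ∀ I, 𝓔.IsProjective I ↔ 𝓔.IsInjective I)
    {X Y Z W I S P Q : E} {f : X ⟶ Y} {g : Y ⟶ Z} {w : f ≫ g = 0}
    (h : 𝓔.Conflation (ShortComplex.mk f g w))
    {j : W ⟶ I} {c : I ⟶ S} {wj : j ≫ c = 0} (hj : 𝓔.Conflation (ShortComplex.mk j c wj))
    (hI : 𝓔.IsInjective I) (hS : ∀ z : S ⟶ Z, ∃ k : S ⟶ Y, k ≫ g = z)
    {p : P ⟶ X} (hp : 𝓔.IsDeflation p) {q : Q ⟶ Y} (hQ : 𝓔.IsProjective Q)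
    (x : W ⟶ X) (hx : ∃ t : W ⟶ Q, t ≫ q = x ≫ f) : ∃ t : W ⟶ P, t ≫ p = x := by
  obtain ⟨a, ha⟩ := hx
  -- `Q` is also injective, so the factorization extends to `I`. Correcting `a' ≫ q` by a map
  -- through `c`, invisible on `W`, makes it land in `X`; thus `x` factors through the projective
  -- `I`.
  obtain ⟨a', rfl⟩ := (hPI Q).1 hQ j (isInflation_of_conflation hj) a
  have := mono_of_conflation h
  obtain ⟨z, hz⟩ := exists_desc_of_conflation hj ((a' ≫ q) ≫ g) (by
    rw [← Category.assoc, ← Category.assoc, ha, Category.assoc, w, comp_zero])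
  obtain ⟨z', rfl⟩ := hS z
  obtain ⟨r, hr⟩ := exists_lift_of_conflation h (a' ≫ q - c ≫ z') (by
    rw [Preadditive.sub_comp, ← hz, Category.assoc, sub_self])
  obtain ⟨t, rfl⟩ := (hPI I).2 hI p hp r
  refine ⟨j ≫ t, ?_⟩
  rw [← cancel_mono f, Category.assoc, Category.assoc, ← Category.assoc t, hr,
    Preadditive.comp_sub, reassoc_of% wj, zero_comp, sub_zero, ← Category.assoc, ha]

/-- Exactness of stable morphisms at the middle term of a conflation. -/
theorem exact_stable (R : Type w) [CommRing R] [Linear R E]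
    {X Y Z P Q O : E} {f : X ⟶ Y} {g : Y ⟶ Z} {w : f ≫ g = 0}
    (h : 𝓔.Conflation (ShortComplex.mk f g w))
    {p : P ⟶ X} {q : Q ⟶ Y} {o : O ⟶ Z} (hq : 𝓔.IsDeflation q)
    (hO : 𝓔.IsProjective O) (hf : ∃ t : P ⟶ Q, t ≫ q = p ≫ f)
    (hg : ∃ t : Q ⟶ O, t ≫ o = q ≫ g) (W : E) :
    Function.Exact (CokerModule.map R f hf W) (CokerModule.map R g hg W) := by
  intro y
  obtain ⟨y, rfl⟩ := Submodule.Quotient.mk_surjective _ y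
  rw [CokerModule.map_mk, CokerModule.mk_eq_zero_iff]
  constructor
  · rintro ⟨a, ha⟩
    obtain ⟨l, hl⟩ := hO g (isDeflation_of_conflation h) o
    obtain ⟨l', hl'⟩ := hO q hq l
    obtain ⟨x, hx⟩ := exists_lift_of_conflation h (y - a ≫ l) (by
      rw [Preadditive.sub_comp, Category.assoc, hl, ha, sub_self])
    refine ⟨Submodule.Quotient.mk x, ?_⟩
    rw [CokerModule.map_mk, ← sub_eq_zero, ← Submodule.Quotient.mk_sub,
      CokerModule.mk_eq_zero_iff]
    refine ⟨-(a ≫ l'), ?_⟩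
    rw [hx, Preadditive.neg_comp, Category.assoc, hl']
    abel
  · rintro ⟨x, hx⟩
    obtain ⟨x, rfl⟩ := Submodule.Quotient.mk_surjective _ x
    rw [CokerModule.map_mk, ← sub_eq_zero, ← Submodule.Quotient.mk_sub,
      CokerModule.mk_eq_zero_iff] at hx
    obtain ⟨t, ht⟩ := hx
    obtain ⟨s, hs⟩ := hg
    refine ⟨-(t ≫ s), ?_⟩
    rw [Preadditive.neg_comp, Category.assoc, hs, ← Category.assoc, ht, Preadditive.sub_comp,
      Category.assoc, w, comp_zero]
    abel

/-- If one of two conflations with the same terms induces a short exact sequence of stable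
morphisms from `W`, then every morphism from `W` lifts along the deflation of the other one. -/
theorem factors_of_length (R : Type w) [CommRing R] [Linear R E] {X Y Z : E}
    (hP : 𝓔.HasEnoughProjectives) (W : E)
    (hfin : ∀ {X Y Z : E} {f : X ⟶ Y} {g : Y ⟶ Z} {w : f ≫ g = 0},
      𝓔.Conflation (ShortComplex.mk f g w) → Module.length R (CokerModule R g W) ≠ ⊤)
    {f₁ f₂ : X ⟶ Y} {g₁ g₂ : Y ⟶ Z} {w₁ : f₁ ≫ g₁ = 0} {w₂ : f₂ ≫ g₂ = 0}
    (h₁ : 𝓔.Conflation (ShortComplex.mk f₁ g₁ w₁)) (h₂ : 𝓔.Conflation (ShortComplex.mk f₂ g₂ w₂))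
    (hinj : ∀ {P Q : E} {p : P ⟶ X} {q : Q ⟶ Y}, 𝓔.IsDeflation p → 𝓔.IsProjective Q →
      ∀ x : W ⟶ X, (∃ t : W ⟶ Q, t ≫ q = x ≫ f₁) → ∃ t : W ⟶ P, t ≫ p = x)
    (hsurj : ∀ z : W ⟶ Z, ∃ k : W ⟶ Y, k ≫ g₁ = z) (z : W ⟶ Z) : ∃ k : W ⟶ Y, k ≫ g₂ = z := by
  -- For a deflation `p` from a projective, `CokerModule R p W` is the stable Hom module from `W` to
  -- the target of `p`.
  obtain ⟨P, p, hPp, KP, iP, wP, hp⟩ := hP X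
  obtain ⟨Q, q, hQ, KQ, iQ, wQ, hq⟩ := hP Y
  obtain ⟨O, o, hO, KO, iO, wO, ho⟩ := hP Z
  have hqd := isDeflation_of_conflation hq
  have hod := isDeflation_of_conflation ho
  have hf : ∀ f : X ⟶ Y, ∃ t : P ⟶ Q, t ≫ q = p ≫ f := fun f ↦ hPp q hqd _
  have hg : ∀ g : Y ⟶ Z, ∃ t : Q ⟶ O, t ≫ o = q ≫ g := fun g ↦ hQ o hod _
  have e₁ : Module.length R (CokerModule R q W) =
      Module.length R (CokerModule R p W) + Module.length R (CokerModule R o W) := by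
    refine Module.length_eq_add_of_exact (CokerModule.map R f₁ (hf f₁) W)
      (CokerModule.map R g₁ (hg g₁) W) ?_ ?_ (exact_stable R h₁ hqd hO (hf f₁) (hg g₁) W)
    · rw [injective_iff_map_eq_zero]
      intro y hy
      obtain ⟨y, rfl⟩ := Submodule.Quotient.mk_surjective _ y
      rw [CokerModule.map_mk, CokerModule.mk_eq_zero_iff] at hy
      rw [CokerModule.mk_eq_zero_iff]
      exact hinj (isDeflation_of_conflation hp) hQ y hy
    · intro y
      obtain ⟨y, rfl⟩ := Submodule.Quotient.mk_surjective _ y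
      obtain ⟨k, rfl⟩ := hsurj y
      exact ⟨Submodule.Quotient.mk k, CokerModule.map_mk ..⟩
  set α := CokerModule.map R f₂ (hf f₂) W
  set β := CokerModule.map R g₂ (hg g₂) W
  have hex : Function.Exact α β := exact_stable R h₂ hqd hO (hf f₂) (hg g₂) W
  have e₂ : Module.length R (CokerModule R q W) =
      Module.length R (LinearMap.ker β) + Module.length R (LinearMap.range β) :=
    Module.length_eq_add_of_exact (LinearMap.ker β).subtype β.rangeRestrict
      Subtype.val_injective β.surjective_rangeRestrict (by
        rw [LinearMap.exact_iff, LinearMap.ker_rangeRestrict, Submodule.range_subtype])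
  have e₃ : Module.length R (LinearMap.ker β) ≤ Module.length R (CokerModule R p W) := by
    rw [LinearMap.exact_iff.1 hex]
    exact Module.length_le_of_surjective α.rangeRestrict α.surjective_rangeRestrict
  have e₄ : Module.length R (CokerModule R o W) =
      Module.length R (LinearMap.range β) +
        Module.length R (CokerModule R o W ⧸ LinearMap.range β) :=
    Module.length_eq_add_of_exact (LinearMap.range β).subtype (LinearMap.range β).mkQ
      Subtype.val_injective (Submodule.mkQ_surjective _) (by
        rw [LinearMap.exact_iff, Submodule.ker_mkQ, Submodule.range_subtype])
  have hX := hfin hp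
  have hZ := hfin ho
  -- The middle length is the sum of the outer ones by the first conflation. In the second sequence
  -- the kernel of `β` is no longer than the left term, so finiteness leaves no room for a cokernel.
  have e₅ : Module.length R (CokerModule R o W ⧸ LinearMap.range β) = 0 := by
    have e₆ := e₁.symm.trans e₂
    rw [e₄] at hZ e₆
    generalize Module.length R (CokerModule R p W) = x at *
    generalize Module.length R (LinearMap.ker β) = y at *
    generalize Module.length R (LinearMap.range β) = z at *
    generalize Module.length R (CokerModule R o W ⧸ LinearMap.range β) = t at *
    lift x to ℕ using hX
    obtain ⟨hz, ht⟩ := WithTop.add_ne_top.1 hZ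
    lift z to ℕ using hz
    lift t to ℕ using ht
    lift y to ℕ using ne_top_of_le_ne_top (ENat.natCast_ne_top x) e₃
    norm_cast at *
    omega
  rw [Module.length_eq_zero_iff, Submodule.Quotient.subsingleton_iff] at e₅
  obtain ⟨y, hy⟩ : (Submodule.Quotient.mk z : CokerModule R o W) ∈ LinearMap.range β :=
    e₅ ▸ trivial
  obtain ⟨y, rfl⟩ := Submodule.Quotient.mk_surjective _ y
  rw [CokerModule.map_mk, ← sub_eq_zero, ← Submodule.Quotient.mk_sub,
    CokerModule.mk_eq_zero_iff] at hy
  obtain ⟨t, ht⟩ := hy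
  obtain ⟨l, hl⟩ := hO g₂ (isDeflation_of_conflation h₂) o
  exact ⟨y - t ≫ l, by rw [Preadditive.sub_comp, Category.assoc, hl, ht]; abel⟩

/-- If a non-projective direct summand `V` of the cosyzygy `S` of `W` is a direct summand of `T`,
then `W` is a direct summand of the syzygy `K` of `T`. -/
theorem retract_syzygy {W I S K P T V : E} (hW : HasLocalEnd W)
    {j : W ⟶ I} {c : I ⟶ S} {wj : j ≫ c = 0} (hj : 𝓔.Conflation (ShortComplex.mk j c wj))
    (hI : 𝓔.IsProjective I)
    {k : K ⟶ P} {q : P ⟶ T} {wk : k ≫ q = 0} (hk : 𝓔.Conflation (ShortComplex.mk k q wk))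
    (hP : 𝓔.IsProjective P) (hV : ¬ 𝓔.IsProjective V) (rS : Retract V S) (rT : Retract V T) :
    Nonempty (Retract W K) := by
  have := mono_of_conflation hj
  have := epi_of_conflation hj
  -- Lift `S ⟶ V ⟶ T` and `T ⟶ V ⟶ S` to the presentations, and restrict to the kernels to get `W ⟶
  -- K ⟶ W`. If this composite is not invertible, the aim is to make `V` projective.
  obtain ⟨a, ha⟩ := hI q (isDeflation_of_conflation hk) (c ≫ rS.r ≫ rT.i)
  obtain ⟨b, hb⟩ := hP c (isDeflation_of_conflation hj) (q ≫ rT.r ≫ rS.i)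
  obtain ⟨a₀, ha₀⟩ := exists_lift_of_conflation hk (j ≫ a) (by
    rw [Category.assoc, ha, reassoc_of% wj, zero_comp])
  obtain ⟨b₀, hb₀⟩ := exists_lift_of_conflation hj (k ≫ b) (by
    rw [Category.assoc, hb, reassoc_of% wk, zero_comp])
  have hab : a ≫ b ≫ c = c ≫ rS.r ≫ rS.i := by
    rw [hb, reassoc_of% ha, rT.retract_assoc]
  have hab₀ : (a₀ ≫ b₀) ≫ j = j ≫ a ≫ b := by
    rw [Category.assoc, hb₀, reassoc_of% ha₀]
  rcases hW (a₀ ≫ b₀) (𝟙 W - a₀ ≫ b₀) (by abel) with hi | hi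
  · exact ⟨⟨a₀, b₀ ≫ inv (a₀ ≫ b₀), by rw [← Category.assoc]; exact IsIso.hom_inv_id _⟩⟩
  · refine absurd ?_ hV
    -- `a ≫ b` covers the idempotent of `S` defining `V`, so it is idempotent modulo maps into `W`.
    obtain ⟨m, hm⟩ := exists_lift_of_conflation hj ((a ≫ b) ≫ (𝟙 I - a ≫ b)) (by
      simp only [Preadditive.comp_sub, Preadditive.sub_comp, Category.assoc, Category.comp_id,
        hab]
      rw [reassoc_of% hab, rS.retract_assoc, sub_self])
    have h1 : (a₀ ≫ b₀) ≫ (𝟙 W - a₀ ≫ b₀) = j ≫ m := by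
      rw [← cancel_mono j, Category.assoc _ m, hm, Category.assoc _ _ j, Preadditive.sub_comp, hab₀,
        Category.id_comp, Preadditive.comp_sub, ← Category.assoc (a₀ ≫ b₀) j, hab₀]
      simp only [Preadditive.comp_sub, Category.comp_id, Category.assoc]
    have h2 : a₀ ≫ b₀ = j ≫ m ≫ inv (𝟙 W - a₀ ≫ b₀) := by
      rw [← Category.assoc j, ← h1, Category.assoc _ _ (inv _), IsIso.hom_inv_id, Category.comp_id]
    -- As `a₀ ≫ b₀` extends along `j`, subtracting the extension makes `a ≫ b` descend to `S`; the
    -- result lifts the idempotent through `c` and makes `V` a retract of `I`.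
    obtain ⟨d, hd⟩ := exists_desc_of_conflation hj
      (a ≫ b - (m ≫ inv (𝟙 W - a₀ ≫ b₀)) ≫ j) (by
        rw [Preadditive.comp_sub, ← hab₀, ← Category.assoc j, ← h2, sub_self])
    have h3 : d ≫ c = rS.r ≫ rS.i := by
      rw [← cancel_epi c, reassoc_of% hd]
      simp only [Preadditive.sub_comp, Category.assoc, wj, comp_zero, sub_zero, hab]
    refine hI.of_comp_eq_id (rS.i ≫ d) (c ≫ rS.r) ?_
    rw [Category.assoc, reassoc_of% h3, rS.retract_assoc, rS.retract]

end Frobenius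

end ExactStructure

/-! ### Conservation of finiteness: comparison of the supports. -/

theorem proposition4p12 {R : Type w} [CommRing R] [IsLocalRing R] [IsNoetherianRing R]
    [IsAdicComplete (IsLocalRing.maximalIdeal R) R]
    {E : Type u} [Category.{v} E] [Preadditive E] [HasZeroObject E] [HasBinaryBiproducts E] [Linear R E]
    [IsIdempotentComplete E] (𝓔 : ExactStructure E)
    (hHom : HomNoetherian R E) (hAR : 𝓔.HasARConflations)
    (h : (𝓔.HasEnoughProjectives ∧ ∀ X : E, 𝓔.HasFiniteProjectiveDimension X) ∨
      𝓔.IsFrobenius) :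
    𝓔.SatisfiesCF := by
  intro X Y Z f₁ f₂ g₁ g₂ w₁ w₂ h₁ h₂ hfl
  have hloc : ∀ W : E, Indecomposable W → HasLocalEnd W := fun W hW ↦ hW.hasLocalEnd hHom
  have hP : 𝓔.HasEnoughProjectives := h.elim And.left And.left
  have hart : ∀ {X Y Z : E} {f : X ⟶ Y} {g : Y ⟶ Z} {w : f ≫ g = 0}
      (_ : 𝓔.Conflation (ShortComplex.mk f g w)) (W : E), IsArtinian R (CokerModule R g W) :=
    fun hc W ↦ ExactStructure.isArtinian_cokerModule hHom hloc hP hAR.1 hc W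
  have hnoeth : ∀ {Y Z : E} (g : Y ⟶ Z) (W : E), IsNoetherian R (CokerModule R g W) := by
    intro Y Z g W
    have := hHom W Z
    infer_instance
  have hfin : ∀ (W : E) {X Y Z : E} {f : X ⟶ Y} {g : Y ⟶ Z} {w : f ≫ g = 0},
      𝓔.Conflation (ShortComplex.mk f g w) → Module.length R (CokerModule R g W) ≠ ⊤ := by
    intro W X Y Z f g w hc
    have := hart hc W
    have := hnoeth g W
    exact Module.length_ne_top
  have := hfl.wellFoundedGT
  have := hfl.wellFoundedLT
  obtain ⟨T, hT⟩ := exists_retract_of_wellFounded hHom hloc (cokerHom g₁)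
  replace hT : ∀ W, Indecomposable W → (∃ z : W ⟶ Z, ¬ ∃ k : W ⟶ Y, k ≫ g₁ = z) →
      Nonempty (Retract W T) := by
    rintro W hW ⟨z, hz⟩
    exact hT W hW (cokerMk g₁ z) (mt (cokerMk_eq_zero_iff g₁ z).1 hz)
  suffices hT₂ : ∃ T₂ : E, ∀ W, Indecomposable W → ∀ f : W ⟶ Z, (¬ ∃ k : W ⟶ Y, k ≫ g₂ = f) →
      Nonempty (Retract W T₂) by
    obtain ⟨T₂, hT₂⟩ := hT₂
    have := hart h₂ T₂
    have := hnoeth g₂ T₂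
    exact hasFiniteLength_cokerHom g₂ R hHom T₂ hT₂
  rcases h with ⟨-, hpd⟩ | ⟨-, hI, hPI⟩
  · refine ⟨T, fun W hW z hz ↦ hT W hW ?_⟩
    by_contra! hcon
    refine hz ((CokerModule.subsingleton_iff g₂ R W).1 ?_ z)
    obtain ⟨a, ha⟩ := (hpd X).exists_projDimLE
    obtain ⟨b, hb⟩ := (hpd Y).exists_projDimLE
    obtain ⟨c, hc⟩ := (hpd Z).exists_projDimLE
    rw [← Module.length_eq_zero_iff (R := R),
      ← ExactStructure.length_cokerModule_eq R W (hfin W) ha hb hc h₁ h₂,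
      Module.length_eq_zero_iff, CokerModule.subsingleton_iff]
    exact hcon
  · obtain ⟨P, q, hPp, K, k, wk, hk⟩ := hP T
    -- `T` accounts for the `W` in the support of the first cokernel, and its syzygy `K` for those
    -- whose cosyzygy meets that support.
    refine ⟨T ⊞ K, fun W hW z hz ↦ ?_⟩
    by_cases hW₁ : ∃ z : W ⟶ Z, ¬ ∃ k : W ⟶ Y, k ≫ g₁ = z
    · obtain ⟨r⟩ := hT W hW hW₁
      exact ⟨⟨r.i ≫ biprod.inl, biprod.fst ≫ r.r, by simp⟩⟩
    obtain ⟨I, j, hIi, S, c, wj, hj⟩ := hI W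
    push Not at hW₁
    by_cases hS : ∀ z : S ⟶ Z, ∃ k : S ⟶ Y, k ≫ g₁ = z
    · exact absurd (ExactStructure.factors_of_length R hP W (hfin W) h₁ h₂
        (fun hp hQ x hx ↦ ExactStructure.exists_factor_of_comp_factors hPI h₁ hj hIi hS hp hQ x hx)
        hW₁ z) hz
    · push Not at hS
      obtain ⟨s, hs⟩ := hS
      obtain ⟨V, hV, ⟨rS⟩, v, hv⟩ := exists_indecomposable_retract hHom g₁ S s
        (by push Not; exact hs)
      obtain ⟨rT⟩ := hT V hV ⟨v, hv⟩
      have hVP : ¬ 𝓔.IsProjective V := fun hVP ↦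
        hv (hVP g₁ (ExactStructure.isDeflation_of_conflation h₁) v)
      obtain ⟨r⟩ := ExactStructure.retract_syzygy (hloc W hW) hj ((hPI I).2 hIi) hk hPp hVP rS rT
      exact ⟨⟨r.i ≫ biprod.inr, biprod.snd ≫ r.r, by simp⟩⟩
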